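/- **Model.** Let $a_k$ ($k\in\mathbb Z\setminus\{0,\pm2\}$) be oscillators, $[a_k,a_l^+]=k\,\delta_{kl}$, $[a_k,a_l]=0$, acting in the Fock space with orthonormal basis $|\{n_k\}\rangle$ ($a_k$ annihilates quanta for $k>0$ and creates them for $k<0$); put $a_0=a_{\pm2}=0$. On this basis $L_0^{(2)}=\sum_k|k|\,n_k$ and $A_3^{(2)}=\sum_k\operatorname{sign}(k)\,n_k$. For an integer spin $S\ge0$ let $S_3,S_\pm$ act on the vectors $|S,m\rangle$, $|m|\le S$, by $S_3|S,m\rangle=m|S,m\rangle$ and $S_\pm|S,m\rangle=\sqrt{S(S+1)-m(m\mp1)}\,|S,m\mp1\rangle$ (the trivial $(2S+1)$-fold degeneracy in the external projection $S^3$ is not counted). Put $\chi_3=S_3-A_3^{(2)}$. Let $$\begin{gathered}\Sigma_+=\sum_{n,k}\tfrac1n a_n^+a_k^+a_{n+k},\quad \Sigma_-=(\Sigma_+)^+,\quad d_+=\tfrac12a_4^+,\quad d_-=\tfrac12a_{-4}^+,\\ f_+=\sum_k\big(\tfrac12+\tfrac1k\big)a_{k+2}^+a_k,\quad f_-=\sum_k\big(\tfrac1k-\tfrac12\big)a_{k-2}^+a_k,\\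 g_+=\sum_{n+k=-2}\tfrac1n a_na_k,\quad g'_-=\sum_{n+k=2,\ (n,k)\ne(1,1)}\tfrac1n a_na_k,\end{gathered}$$ and $d=d_+-d_-$, $f=f_+-f_-$, $g'=g'_--g_+$. Define polynomials $P_n,b_n$ ($n\ge1$) in the commuting symbols $a_1,d_\pm,f_\pm,g_+,g'_-,\Sigma_\pm,S_\pm$, their conjugates ($\Sigma_\pm^*=\Sigma_\mp$, $S_\pm^*=S_\mp$) and the real symbols $\gamma,\gamma^{-1}$ by $P_1=-\Sigma_++S_+/\gamma$, $b_1=0$ and, for $n>1$, $$\begin{aligned}P_n={}&-f^*a_1^{*2}P_{n-1}^*-g'^*a_1^2P_{n-1}-d^*a_1^{*4}\sum_{m=1}^{n-2}P^*_{n-m-1}P^*_m-\tfrac12\,d\,a_1^{*2}a_1^2\sum_{m=1}^{n-2}P_{n-m-1}P_m^*+\tfrac{S_+}{\gamma}\,b_{n-1},\\ b_n={}&a_1^{*2}a_1^2\gamma^2\sum_{m=1}^{n-1}P^*_{n-m}P_m-\tfrac12\sum_{m=1}^{n-1}b_{n-m}b_m.\end{aligned}$$ Fix any normal ordering $:\ :$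 of the elementary operators $a_1,d_\pm,f_\pm,g_+,g'_-$, their adjoints, $\Sigma_\pm,S_\pm,\gamma^{\pm1}$, that is, any linear order of them in which those raising $L_0^{(2)}$ stand to the left of the neutral ones, these to the left of those lowering $L_0^{(2)}$, and $S_+$ to the left of $S_-$. With $c_1,c_2>0$ put $\tilde n_1=a_1^+a_1+c_1$, $\gamma=(L_0^{(2)}+c_2)^{-1/2}$. For $N\in\mathbb N$ let $\alpha_2$ be the matrix of $$\alpha_2=\sum_{n\ge1}\tilde n_1^{-2n+1}:P_n:$$ from the space $\{\chi_3=1,\ L_0^{(2)}\le N\}$ to the space $\{\chi_3=0,\ L_0^{(2)}\le N\}$ at spin $S$ (each matrix element is a finite sum), and let $\dfrac{P^2}{2\pi}=L_0^{(2)}+2\alpha_2\alpha_2^++c_3$ on $\{\chi_3=0,\ L_0^{(2)}\le N\}$, with $c_3=0$. **Lemma (heavy vacuum modes).** For every integer spin $S\ge0$ and every cutoff $N\ge 0$, in the limit $1\ll c_1^2\ll c_2\ll c_1^4$, i.e. $c_1>0$ and $c_1^2\to\infty$, $c_2/c_1^2\to\infty$, $c_1^4/c_2\to\infty$: 1. $\alpha_2^+=S_-\cdot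 c_2^{1/2}/c_1+o(1)$. 2. The spectrum of $(P^2/2\pi,S)$ tends, with multiplicities, to the spectrum of $(L_0^{(2)},A_3^{(2)}\ge0)$: for all $0<\varepsilon<1$ and $R\in\mathbb R$, sufficiently far in this limit, for each integer $0\le\ell\le N$ the number of eigenvalues of $P^2/2\pi$ at spin $S$ (with multiplicity) in $(\ell-\varepsilon,\ell+\varepsilon)$ equals the multiplicity of the point $(L_0^{(2)},A_3^{(2)})=(\ell,S)$, i.e. the number of $\{n_k\}$ with $\sum|k|n_k=\ell$ and $\sum\operatorname{sign}(k)n_k=S$, and every eigenvalue $\le R$ lies within $\varepsilon$ of some integer $\ell\in\{0,\dots,N\}$ (the remaining eigenvalues go to infinity). -/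

import Mathlib

open Filter Topology

noncomputable section

namespace LightConeString

/-! ### States -/

/-- The oscillator modes are labelled by the integers different from `0`, `2` and `-2`. -/
abbrev Mode : Type := {k : ℤ // k ≠ 0 ∧ k ≠ 2 ∧ k ≠ -2}

/-- Occupation numbers `n_k`, almost all of them zero: the vectors `|{n_k}⟩`. -/
abbrev Occ : Type := Mode →₀ ℕ

/-- The possible values `S₃ = -S, …, S` of the (body fixed) third spin component. The value of
`S³` gives only a trivial `(2S+1)`-fold degeneracy and is suppressed. -/
abbrev SpinZ (S : ℕ) : Type := {m : ℤ // |m| ≤ (S : ℤ)}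

/-- Labels `|{n_k}⟩ |S, S₃⟩` of the orthonormal basis of the states of spin `S`. -/
abbrev State (S : ℕ) : Type := Occ × SpinZ S

/-- The number `n_k` of quanta in a mode `k`, for every integer `k`. -/
def occNum (n : Occ) (k : ℤ) : ℕ :=
  if h : k ≠ 0 ∧ k ≠ 2 ∧ k ≠ -2 then n ⟨k, h⟩ else 0

/-- Eigenvalue of `L₀⁽²⁾ = ∑ a_k⁺ a_k` (vacuum value `0`): `∑ |k| n_k`. -/
def levelL0 (n : Occ) : ℕ := n.sum fun k c => k.1.natAbs * c

/-- Eigenvalue of `A₃⁽²⁾ = ∑ a_k⁺ a_k / k` (vacuum value `0`): `∑ sign(k) n_k`. -/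
def levelA3 (n : Occ) : ℤ := n.sum fun k c => k.1.sign * (c : ℤ)

/-- Finite linear combinations of basis states. -/
abbrev Vec (S : ℕ) : Type := State S →₀ ℂ

/-- Operators on finite linear combinations of basis states. -/
abbrev Op (S : ℕ) : Type := Module.End ℂ (Vec S)

/-- The basis vector with label `s`. -/
def ket {S : ℕ} (s : State S) : Vec S := Finsupp.single s 1

/-- The operator with prescribed values on the basis vectors. -/
def opOf {S : ℕ} (v : State S → Vec S) : Op S := Finsupp.linearCombination ℂ v

/-- The operator that multiplies every basis vector `s` by the number `w s`. -/
def diagOp {S : ℕ} (w : State S → ℝ) : Op S := opOf fun s => ((w s : ℝ) : ℂ) • ket s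

/-- The sum of a family of operators of which only finitely many act non-trivially on each basis
vector. -/
def sumOp {S : ℕ} {ι : Type} (T : ι → Op S) : Op S := opOf fun s => ∑ᶠ i, T i (ket s)

/-! ### Oscillators: `[a_k, a_l⁺] = k δ_{kl}` -/

/-- Removes a quantum of the mode `k`: `|n_k⟩ ↦ √(|k| n_k) |n_k - 1⟩`. -/
def removeQuantum (S : ℕ) (k : Mode) : Op S := opOf fun s =>
  ((Real.sqrt (|(k.1 : ℝ)| * (s.1 k : ℝ)) : ℝ) : ℂ) • ket (s.1 - Finsupp.single k 1, s.2)

/-- Adds a quantum of the mode `k`: `|n_k⟩ ↦ √(|k| (n_k + 1)) |n_k + 1⟩`. -/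
def addQuantum (S : ℕ) (k : Mode) : Op S := opOf fun s =>
  ((Real.sqrt (|(k.1 : ℝ)| * ((s.1 k : ℝ) + 1)) : ℝ) : ℂ) • ket (s.1 + Finsupp.single k 1, s.2)

/-- The operator `a_k`: it annihilates quanta for `k > 0`, creates them for `k < 0`, and is `0` for
`k ∈ {0, 2, -2}`. -/
def osc (S : ℕ) (k : ℤ) : Op S :=
  if h : k ≠ 0 ∧ k ≠ 2 ∧ k ≠ -2 then
    if 0 < k then removeQuantum S ⟨k, h⟩ else addQuantum S ⟨k, h⟩
  else 0

/-- The operator `a_k⁺`, the adjoint of `a_k`. -/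
def oscAdj (S : ℕ) (k : ℤ) : Op S :=
  if h : k ≠ 0 ∧ k ≠ 2 ∧ k ≠ -2 then
    if 0 < k then addQuantum S ⟨k, h⟩ else removeQuantum S ⟨k, h⟩
  else 0

/-! ### Spin components: `[S₊, S₋] = -2 S₃`, and `S₊` lowers `S₃` -/

/-- `S₊ |S, m⟩ = √(S(S+1) - m(m-1)) |S, m-1⟩`. -/
def spinPlus (S : ℕ) : Op S := opOf fun s =>
  if h : |s.2.1 - 1| ≤ (S : ℤ) then
    ((Real.sqrt ((S : ℝ) * (S + 1) - s.2.1 * (s.2.1 - 1)) : ℝ) : ℂ) • ket (s.1, ⟨s.2.1 - 1, h⟩)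
  else 0

/-- `S₋ |S, m⟩ = √(S(S+1) - m(m+1)) |S, m+1⟩`. -/
def spinMinus (S : ℕ) : Op S := opOf fun s =>
  if h : |s.2.1 + 1| ≤ (S : ℤ) then
    ((Real.sqrt ((S : ℝ) * (S + 1) - s.2.1 * (s.2.1 + 1)) : ℝ) : ℂ) • ket (s.1, ⟨s.2.1 + 1, h⟩)
  else 0

/-! ### Elementary variables -/

/-- Families of elementary variables that change `L₀⁽²⁾`. -/
inductive Family
  | a1 | dPlus | dMinus | fPlus | fMinus | gPlus | gMinus

/-- Elementary variables. Each family consists of an `L₀⁽²⁾`-raising member (`up`) and its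
conjugate, which lowers `L₀⁽²⁾` (`down`):
`a₁*, d₊, d₋*, f₊, f₋*, g₊, g'₋*` raise and `a₁, d₊*, d₋, f₊*, f₋, g₊*, g'₋` lower.
The others are `Σ₊, Σ₋, S₊, S₋, γ, γ⁻¹`. -/
inductive Var
  | up (x : Family)
  | down (x : Family)
  | sigmaPlus | sigmaMinus | sPlus | sMinus | gam | gamInv

/-- Conjugation of elementary variables. -/
def Var.conj : Var → Var
  | up x => down x
  | down x => up x
  | sigmaPlus => sigmaMinus
  | sigmaMinus => sigmaPlus
  | sPlus => sMinus
  | sMinus => sPlus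
  | gam => gam
  | gamInv => gamInv

/-- Commutative polynomials in the elementary variables: classical expressions. -/
abbrev ClassicalExpr : Type := MvPolynomial Var ℝ

/-- Complex conjugation of classical expressions. -/
def conj : ClassicalExpr →ₐ[ℝ] ClassicalExpr := MvPolynomial.rename Var.conj

def symA : ClassicalExpr := .X (.down .a1)
/-- `d = d₊ - d₋`. -/
def symD : ClassicalExpr := .X (.up .dPlus) - .X (.down .dMinus)
/-- `f = f₊ - f₋`. -/
def symF : ClassicalExpr := .X (.up .fPlus) - .X (.down .fMinus)
/-- `g' = g'₋ - g₊`. -/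
def symG : ClassicalExpr := .X (.down .gMinus) - .X (.up .gPlus)
/-- `S₊ / γ`. -/
def symS : ClassicalExpr := .X .sPlus * .X .gamInv
/-- `γ²`. -/
def symGamSq : ClassicalExpr := .X .gam ^ 2

/-- The pairs `(P_n, b_n)` of coefficients of the classical expansions
`a₂ = ∑ P_n a₁² / |a₁|^{4n}` and `√(P²/2π) = (1 + ∑ b_n / |a₁|^{4n}) / γ`, for `n ≥ 1`. They are
determined by
`P_1 = -Σ₊ + S₊/γ`, `b_1 = 0` and, for `n > 1`,
`P_n = - f* a₁*² P*_{n-1} - g'* a₁² P_{n-1} - d* a₁*⁴ ∑_{1 ≤ m ≤ n-2} P*_{n-m-1} P*_m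
- (1/2) d a₁*² a₁² ∑_{1 ≤ m ≤ n-2} P_{n-m-1} P*_m + (S₊/γ) b_{n-1}`,
`b_n = a₁*² a₁² γ² ∑_{1 ≤ m ≤ n-1} P*_{n-m} P_m - (1/2) ∑_{1 ≤ m ≤ n-1} b_{n-m} b_m`.
The value at `n = 0` is not used. -/
def expansionPair : ℕ → ClassicalExpr × ClassicalExpr
  | 0 => (0, 0)
  | 1 => (- .X .sigmaPlus + symS, 0)
  | n + 2 =>
    (- (conj symF * conj symA ^ 2 * conj (expansionPair (n + 1)).1)
      - conj symG * symA ^ 2 * (expansionPair (n + 1)).1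
      - conj symD * conj symA ^ 4 *
          ∑ m : Fin n, conj (expansionPair (n - m)).1 * conj (expansionPair (m + 1)).1
      - MvPolynomial.C (1 / 2) * symD * conj symA ^ 2 * symA ^ 2 *
          ∑ m : Fin n, (expansionPair (n - m)).1 * conj (expansionPair (m + 1)).1
      + symS * (expansionPair (n + 1)).2,
     conj symA ^ 2 * symA ^ 2 * symGamSq *
          ∑ m : Fin (n + 1), conj (expansionPair (n + 1 - m)).1 * (expansionPair (m + 1)).1
      - MvPolynomial.C (1 / 2) *
          ∑ m : Fin (n + 1), (expansionPair (n + 1 - m)).2 * (expansionPair (m + 1)).2)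
  termination_by n => n
  decreasing_by all_goals omega

/-- The polynomial `P_n`. -/
def polyP (n : ℕ) : ClassicalExpr := (expansionPair n).1

/-! ### Elementary operators -/

/-- The operator of the raising member of a family:
`a₁⁺`, `d₊ = a₄⁺/2`, `d₋⁺` with `d₋ = a₋₄⁺/2`, `f₊ = ∑_k (1/2 + 1/k) a_{k+2}⁺ a_k`,
`f₋⁺` with `f₋ = ∑_k (1/k - 1/2) a_{k-2}⁺ a_k`, `g₊ = ∑_{n+k=-2} (1/n) a_n a_k`,
`g'₋⁺` with `g'₋ = ∑_{n+k=2, (n,k)≠(1,1)} (1/n) a_n a_k`. -/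
def upOp (S : ℕ) : Family → Op S
  | .a1 => oscAdj S 1
  | .dPlus => (1 / 2 : ℂ) • oscAdj S 4
  | .dMinus => (1 / 2 : ℂ) • osc S (-4)
  | .fPlus => sumOp fun k : ℤ => (1 / 2 + 1 / (k : ℂ)) • (oscAdj S (k + 2) * osc S k)
  | .fMinus => sumOp fun k : ℤ => (1 / (k : ℂ) - 1 / 2) • (oscAdj S k * osc S (k - 2))
  | .gPlus => sumOp fun n : ℤ => (1 / (n : ℂ)) • (osc S n * osc S (-2 - n))
  | .gMinus => sumOp fun n : {n : ℤ // n ≠ 1} =>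
      (1 / (n.1 : ℂ)) • (oscAdj S (2 - n.1) * oscAdj S n.1)

/-- The operator of the lowering member of a family, the adjoint of the raising one. -/
def downOp (S : ℕ) : Family → Op S
  | .a1 => osc S 1
  | .dPlus => (1 / 2 : ℂ) • osc S 4
  | .dMinus => (1 / 2 : ℂ) • oscAdj S (-4)
  | .fPlus => sumOp fun k : ℤ => (1 / 2 + 1 / (k : ℂ)) • (oscAdj S k * osc S (k + 2))
  | .fMinus => sumOp fun k : ℤ => (1 / (k : ℂ) - 1 / 2) • (oscAdj S (k - 2) * osc S k)
  | .gPlus => sumOp fun n : ℤ => (1 / (n : ℂ)) • (oscAdj S (-2 - n) * oscAdj S n)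
  | .gMinus => sumOp fun n : {n : ℤ // n ≠ 1} => (1 / (n.1 : ℂ)) • (osc S n.1 * osc S (2 - n.1))

/-- `Σ₊ = ∑_{n,k} (1/n) a_n⁺ a_k⁺ a_{n+k}`. -/
def sigmaPlusOp (S : ℕ) : Op S := sumOp fun p : ℤ × ℤ =>
  (1 / (p.1 : ℂ)) • (oscAdj S p.1 * oscAdj S p.2 * osc S (p.1 + p.2))

/-- `Σ₋ = ∑_{n,k} (1/n) a_{n+k}⁺ a_k a_n`. -/
def sigmaMinusOp (S : ℕ) : Op S := sumOp fun p : ℤ × ℤ =>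
  (1 / (p.1 : ℂ)) • (oscAdj S (p.1 + p.2) * osc S p.2 * osc S p.1)

/-- The operators of the elementary variables; here `γ = (L₀⁽²⁾ + c₂)^{-1/2}`. -/
def varOp (S : ℕ) (c₂ : ℝ) : Var → Op S
  | .up x => upOp S x
  | .down x => downOp S x
  | .sigmaPlus => sigmaPlusOp S
  | .sigmaMinus => sigmaMinusOp S
  | .sPlus => spinPlus S
  | .sMinus => spinMinus S
  | .gam => diagOp fun s => (Real.sqrt ((levelL0 s.1 : ℝ) + c₂))⁻¹
  | .gamInv => diagOp fun s => Real.sqrt ((levelL0 s.1 : ℝ) + c₂)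

/-! ### Normal ordering -/

/-- `0` for `L₀⁽²⁾`-raising variables, `1` for neutral ones, `2` for lowering ones. -/
def Var.grade : Var → ℕ
  | up _ => 0
  | down _ => 2
  | _ => 1

/-- A normal ordering of the elementary operators, from left to right: a list in which each
occurs once, the raising operators stand to the left of the neutral ones, these to the left of the
lowering ones, and `S₊` stands to the left of `S₋`. -/
structure IsNormalOrder (l : List Var) : Prop where
  nodup : l.Nodup
  mem : ∀ x, x ∈ l
  grade : l.Pairwise fun x y => x.grade ≤ y.grade
  spin : [Var.sPlus, Var.sMinus].Sublist l

/-- The linear map `p ↦ :p:`, which replaces every monomial by the product of the elementary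
operators in the order prescribed by `l`. -/
def normalOrder (l : List Var) (S : ℕ) (c₂ : ℝ) : ClassicalExpr →ₗ[ℝ] Op S :=
  (MvPolynomial.basisMonomials Var ℝ).constr ℝ fun m => (l.map fun x => varOp S c₂ x ^ m x).prod

/-! ### The operators `α₂` and `P²/2π` in the space `L₀⁽²⁾ ≤ N` -/

/-- The term `ñ₁^{-2n+1} :P_n:` of `α₂`, where `ñ₁ = a₁⁺ a₁ + c₁`. -/
def alphaTerm (l : List Var) (S : ℕ) (c₁ c₂ : ℝ) (n : ℕ) : Op S :=
  diagOp (fun s => ((occNum s.1 1 : ℝ) + c₁) ^ (-2 * (n : ℤ) + 1)) * normalOrder l S c₂ (polyP n)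

/-- Labels of the basis of the space `L₀⁽²⁾ ≤ N`, `χ₃ = S₃ - A₃⁽²⁾ = q`, at spin `S`. -/
abbrev CutState (S N : ℕ) (q : ℤ) : Type :=
  {s : State S // levelL0 s.1 ≤ N ∧ s.2.1 - levelA3 s.1 = q}

theorem finite_occ (N : ℕ) : {n : Occ | levelL0 n ≤ N}.Finite := by
  classical
  have hk : ∀ n : Occ, levelL0 n ≤ N → ∀ k : Mode, k.1.natAbs * n k ≤ N := by
    intro n hn k
    by_cases h : k ∈ n.support
    · exact (Finset.single_le_sum (f := fun k : Mode => k.1.natAbs * n k)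
        (fun _ _ => Nat.zero_le _) h).trans hn
    · simp [Finsupp.notMem_support_iff.mp h]
  have hpos : ∀ k : Mode, 0 < k.1.natAbs := fun k => Int.natAbs_pos.mpr k.2.1
  have hfin : {k : Mode | k.1.natAbs ≤ N}.Finite := by
    refine Set.Finite.of_finite_image (f := Subtype.val) ?_ Subtype.val_injective.injOn
    refine (Set.finite_Icc (-(N : ℤ)) N).subset ?_
    rintro _ ⟨k, hk, rfl⟩
    have hk' : k.1.natAbs ≤ N := hk
    refine Set.mem_Icc.mpr ?_
    omega
  refine Set.Finite.subset
    (Finset.finite_toSet (Finset.finsupp hfin.toFinset fun _ => Finset.range (N + 1))) ?_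
  intro n hn
  simp only [Finset.mem_coe, Finset.mem_finsupp_iff]
  refine ⟨?_, ?_⟩
  · intro k hks
    have h0 : n k ≠ 0 := Finsupp.mem_support_iff.mp hks
    refine hfin.mem_toFinset.mpr ?_
    exact (Nat.le_mul_of_pos_right _ (Nat.pos_of_ne_zero h0)).trans (hk n hn k)
  · intro k _
    have := (Nat.le_mul_of_pos_left (n k) (hpos k)).trans (hk n hn k)
    simpa [Nat.lt_succ_iff] using this

instance (S : ℕ) : Finite (SpinZ S) :=
  ((Set.finite_Icc (-(S : ℤ)) S).subset fun _ h => abs_le.mp h).to_subtype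

instance (S N : ℕ) (q : ℤ) : Finite (CutState S N q) := by
  have h : ({n : Occ | levelL0 n ≤ N} ×ˢ (Set.univ : Set (SpinZ S))).Finite :=
    (finite_occ N).prod Set.finite_univ
  have h' : {s : State S | levelL0 s.1 ≤ N ∧ s.2.1 - levelA3 s.1 = q}.Finite :=
    h.subset fun s hs => ⟨hs.1, trivial⟩
  exact h'.to_subtype

instance (S N : ℕ) (q : ℤ) : Fintype (CutState S N q) := Fintype.ofFinite _

instance (S N : ℕ) (q : ℤ) : DecidableEq (CutState S N q) := Classical.decEq _

/-- The matrix of `α₂ = ∑_{n ≥ 1} ñ₁^{-2n+1} :P_n:`, which maps `χ₃ = 1` to `χ₃ = 0`, in the space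
`L₀⁽²⁾ ≤ N`. For each matrix element only finitely many terms of the series are non-zero. -/
def alphaMatrix (l : List Var) (S N : ℕ) (c₁ c₂ : ℝ) :
    Matrix (CutState S N 0) (CutState S N 1) ℂ :=
  .of fun i j => ∑' n : ℕ, alphaTerm l S c₁ c₂ (n + 1) (ket j.1) i.1

/-- The matrix of `S₋`, which maps `χ₃ = 0` to `χ₃ = 1`, in the space `L₀⁽²⁾ ≤ N`. -/
def spinMinusMatrix (S N : ℕ) : Matrix (CutState S N 1) (CutState S N 0) ℂ :=
  .of fun i j => spinMinus S (ket j.1) i.1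

/-- The matrix of `P²/2π = L₀⁽²⁾ + 2 α₂ α₂⁺ + c₃` on the physical states `χ₃ = 0` of spin `S` in the
space `L₀⁽²⁾ ≤ N`. -/
def massMatrix (l : List Var) (S N : ℕ) (c₁ c₂ c₃ : ℝ) :
    Matrix (CutState S N 0) (CutState S N 0) ℂ :=
  Matrix.diagonal (fun s => (levelL0 s.1.1 : ℂ))
    + (2 : ℂ) • (alphaMatrix l S N c₁ c₂ * (alphaMatrix l S N c₁ c₂).conjTranspose)
    + Matrix.diagonal (fun _ => (c₃ : ℂ))

theorem massMatrix_isHermitian (l : List Var) (S N : ℕ) (c₁ c₂ c₃ : ℝ) :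
    (massMatrix l S N c₁ c₂ c₃).IsHermitian := by
  unfold massMatrix
  refine Matrix.IsHermitian.add (Matrix.IsHermitian.add ?_ ?_) ?_
  · exact Matrix.isHermitian_diagonal_of_self_adjoint _ (by ext; simp)
  · have := Matrix.isHermitian_mul_conjTranspose_self (alphaMatrix l S N c₁ c₂)
    simp only [Matrix.IsHermitian, Matrix.conjTranspose_smul] at *
    simp [this]
  · exact Matrix.isHermitian_diagonal_of_self_adjoint _ (by ext; simp)

/-- The eigenvalues of `P²/2π`, repeated according to their multiplicity. -/
def massEigenvalues (l : List Var) (S N : ℕ) (c₁ c₂ c₃ : ℝ) : CutState S N 0 → ℝ :=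
  (massMatrix_isHermitian l S N c₁ c₂ c₃).eigenvalues

/-- The multiplicity of the point `(L₀⁽²⁾, A₃⁽²⁾) = (ℓ, A)` of the spectrum of `(L₀⁽²⁾, A₃⁽²⁾)`. -/
def oscMultiplicity (ℓ : ℕ) (A : ℤ) : ℕ := Nat.card {n : Occ // levelL0 n = ℓ ∧ levelA3 n = A}

/-- The limit `1 ≪ c₁² ≪ c₂ ≪ c₁⁴`, `c₁ > 0`, on the pairs `(c₁, c₂)`. -/
def heavyVacuumLimit : Filter (ℝ × ℝ) :=
  comap (fun c => c.1 ^ 2) atTop ⊓ comap (fun c => c.2 / c.1 ^ 2) atTop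
    ⊓ comap (fun c => c.1 ^ 4 / c.2) atTop ⊓ 𝓟 {c | 0 < c.1}

end LightConeString

end

open LightConeString

/-! The proof combines power counting in `c₁`, `c₂` with an eigenvalue count for a large penalty
term.

Power counting: by induction along the recursion (`weightBound_expansionPair`), every monomial of
`P_n` has at least `n - 1` factors that change `L₀⁽²⁾` and a net power of `γ⁻¹` of at most `(n + 1)
/ 2`. In a normal ordered monomial the lowering factors act first and the raising ones last, so
between states of level at most `N` at most `N` of each can occur (`monomialOp_apply_ne_zero`), and
the series stops at `n = 2N + 1`. Since `γ⁻¹` is of order `√c₂` and `√c₂ ≪ c₁²`, all terms with `n ≥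
2` are `O(1 / c₁)`. In the term `n = 1` the part with `Σ₊` is also `O(1 / c₁)`, and `S₊ / γ` leaves
`(√c₂ / c₁) S₊`. Taking adjoints gives the first claim (`tendsto_alphaMatrix`).

Penalty: hence `P²/2π` is `L₀⁽²⁾ + 2 A Aᴴ` with `Aᴴ = r S₋ + o(1)` and `r = √c₂ / c₁ → ∞`. The
matrix of `S₊ S₋` is diagonal with entries `(S - m)(S + m + 1)`, which vanish for `m = S` and are at
least `1` otherwise. States with `m ≠ S` are pushed to infinity; on those with `m = S`, where `χ₃ =
0` means `A₃⁽²⁾ = S`, only `L₀⁽²⁾` survives. Comparing quadratic forms on coordinate subspaces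
(`card_le_card_eigenvalues_le`, `card_eigenvalues_lt_le_card`) turns this into exact counts
(`eigenvalues_cluster`). -/

namespace LightConeString

/-! ### Eigenvalue counts for a diagonal matrix with a large penalty term. -/

section Spectrum

open Matrix

variable {n m : Type*} [Fintype n] [Fintype m]

/-- The squared Euclidean norm of a complex vector. -/
noncomputable def normSqSum (v : n → ℂ) : ℝ := ∑ i, ‖v i‖ ^ 2

lemma star_dotProduct_self (v : n → ℂ) : star v ⬝ᵥ v = (normSqSum v : ℂ) := by
  simp only [dotProduct, normSqSum, Pi.star_apply, RCLike.star_def, Complex.conj_mul']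
  push_cast
  rfl

lemma star_dotProduct_conjTranspose_mul (B : Matrix m n ℂ) (v : n → ℂ) :
    star v ⬝ᵥ (Bᴴ * B) *ᵥ v = (normSqSum (B *ᵥ v) : ℂ) := by
  rw [← mulVec_mulVec, dotProduct_mulVec, ← star_mulVec, star_dotProduct_self]

lemma star_dotProduct_diagonal [DecidableEq n] (d : n → ℝ) (v : n → ℂ) :
    star v ⬝ᵥ diagonal (fun i => (d i : ℂ)) *ᵥ v = ((∑ i, d i * ‖v i‖ ^ 2 : ℝ) : ℂ) := by
  simp only [dotProduct, mulVec_diagonal, Pi.star_apply, RCLike.star_def]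
  push_cast
  refine Finset.sum_congr rfl fun i _ => ?_
  rw [← Complex.conj_mul']
  ring

lemma normSqSum_pos {v : n → ℂ} (hv : v ≠ 0) : 0 < normSqSum v := by
  obtain ⟨i, hi⟩ := Function.ne_iff.mp hv
  refine Finset.sum_pos' (fun _ _ => by positivity) ⟨i, Finset.mem_univ _, ?_⟩
  have : 0 < ‖v i‖ := norm_pos_iff.mpr hi
  positivity

lemma normSqSum_mulVec_le (E : Matrix m n ℂ) (v : n → ℂ) :
    normSqSum (E *ᵥ v) ≤ (∑ i, ∑ j, ‖E i j‖ ^ 2) * normSqSum v := by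
  unfold normSqSum
  rw [Finset.sum_mul]
  refine Finset.sum_le_sum fun i _ => ?_
  calc ‖(E *ᵥ v) i‖ ^ 2 ≤ (∑ j, ‖E i j‖ * ‖v j‖) ^ 2 := by
        gcongr
        simp only [mulVec, dotProduct]
        refine (norm_sum_le _ _).trans (le_of_eq ?_)
        simp
    _ ≤ _ := Finset.sum_mul_sq_le_sq_mul_sq _ _ _

/-- Dimension count: `K` imposes fewer linear conditions than there are free coordinates in `J`.
With `B` the passage to eigencoordinates, this replaces the min-max principle below. -/
lemma exists_vector_of_card_lt (B : Matrix n n ℂ) (J K : Finset n) (h : K.card < J.card) :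
    ∃ v : n → ℂ, v ≠ 0 ∧ (∀ i ∉ J, v i = 0) ∧ ∀ i ∈ K, (B *ᵥ v) i = 0 := by
  classical
  let ext : (J → ℂ) →ₗ[ℂ] (n → ℂ) := Function.ExtendByZero.linearMap ℂ Subtype.val
  let f : (J → ℂ) →ₗ[ℂ] (K → ℂ) :=
    LinearMap.funLeft ℂ ℂ Subtype.val ∘ₗ B.mulVecLin ∘ₗ ext
  have hf : LinearMap.ker f ≠ ⊥ := f.ker_ne_bot_of_finrank_lt (by simpa using h)
  obtain ⟨w, hw, hw0⟩ := (Submodule.ne_bot_iff _).mp hf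
  have hext : ∀ j : J, ext w j = w j := fun j =>
    Subtype.val_injective.extend_apply w 0 j
  refine ⟨ext w, ?_, ?_, ?_⟩
  · intro h0
    apply hw0
    funext j
    rw [← hext j, h0]
    rfl
  · intro i hi
    exact Function.extend_apply' _ _ _ (by rintro ⟨j, rfl⟩; exact hi j.2)
  · intro i hi
    exact congrFun (LinearMap.mem_ker.mp hw) ⟨i, hi⟩

variable [DecidableEq n] {M : Matrix n n ℂ} (hM : M.IsHermitian)
include hM

lemma exists_eigenCoordinates : ∃ B : Matrix n n ℂ,
    (∀ v, star v ⬝ᵥ M *ᵥ v = ((∑ i, hM.eigenvalues i * ‖(B *ᵥ v) i‖ ^ 2 : ℝ) : ℂ)) ∧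
    ∀ v, normSqSum v = ∑ i, ‖(B *ᵥ v) i‖ ^ 2 := by
  refine ⟨(hM.eigenvectorUnitary : Matrix n n ℂ)ᴴ, fun v => ?_, fun v => ?_⟩
  · conv_lhs => rw [hM.spectral_theorem, Unitary.conjStarAlgAut_apply]
    rw [← star_dotProduct_diagonal, ← mulVec_mulVec, ← mulVec_mulVec, dotProduct_mulVec,
      star_mulVec, conjTranspose_conjTranspose]
    rfl
  · have h1 : (hM.eigenvectorUnitary : Matrix n n ℂ) *
        (hM.eigenvectorUnitary : Matrix n n ℂ)ᴴ = 1 := Unitary.coe_mul_star_self _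
    have := star_dotProduct_conjTranspose_mul (hM.eigenvectorUnitary : Matrix n n ℂ)ᴴ v
    rw [conjTranspose_conjTranspose, h1, one_mulVec, star_dotProduct_self] at this
    exact_mod_cast this

/-- Otherwise some nonzero vector supported in `J` would have only eigencomponents with eigenvalue
above `μ`, and its form would exceed `μ` times its squared norm. -/
lemma card_le_card_eigenvalues_le (J : Finset n) (μ : ℝ)
    (h : ∀ v : n → ℂ, (∀ i ∉ J, v i = 0) → (star v ⬝ᵥ M *ᵥ v).re ≤ μ * normSqSum v) :
    J.card ≤ (Finset.univ.filter fun i => hM.eigenvalues i ≤ μ).card := by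
  obtain ⟨B, hB, hB'⟩ := exists_eigenCoordinates hM
  by_contra! hlt
  obtain ⟨v, hv0, hvJ, hvK⟩ := exists_vector_of_card_lt B J _ hlt
  have h1 := h v hvJ
  have hpos := normSqSum_pos hv0
  rw [hB, Complex.ofReal_re, hB', Finset.mul_sum] at h1
  rw [hB'] at hpos
  obtain ⟨i, -, hi⟩ := Finset.exists_ne_zero_of_sum_ne_zero hpos.ne'
  refine absurd h1 (not_le.mpr (Finset.sum_lt_sum (fun j _ => ?_) ⟨i, Finset.mem_univ _, ?_⟩))
  · by_cases hj : hM.eigenvalues j ≤ μ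
    · simp [hvK j (by simpa using hj)]
    · push Not at hj
      gcongr
  · have hi' : μ < hM.eigenvalues i := by
      by_contra! hle
      exact hi (by simp [hvK i (by simpa using hle)])
    have : 0 < ‖(B *ᵥ v) i‖ ^ 2 := lt_of_le_of_ne (by positivity) (Ne.symm hi)
    gcongr

lemma card_eigenvalues_lt_le_card (J : Finset n) (μ : ℝ)
    (h : ∀ v : n → ℂ, (∀ i ∈ J, v i = 0) → μ * normSqSum v ≤ (star v ⬝ᵥ M *ᵥ v).re) :
    (Finset.univ.filter fun i => hM.eigenvalues i < μ).card ≤ J.card := by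
  obtain ⟨B, hB, hB'⟩ := exists_eigenCoordinates hM
  by_contra! hlt
  obtain ⟨v, hv0, hvJ, hvK⟩ := exists_vector_of_card_lt B Jᶜ
    (Finset.univ.filter fun i => hM.eigenvalues i < μ)ᶜ (by
      rw [Finset.card_compl, Finset.card_compl]
      have := Finset.card_le_univ (Finset.univ.filter fun i => hM.eigenvalues i < μ)
      omega)
  have h1 := h v fun i hi => hvJ i (by simpa using hi)
  have hpos := normSqSum_pos hv0
  rw [hB, Complex.ofReal_re, hB', Finset.mul_sum] at h1
  rw [hB'] at hpos
  obtain ⟨i, -, hi⟩ := Finset.exists_ne_zero_of_sum_ne_zero hpos.ne'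
  refine absurd h1 (not_le.mpr (Finset.sum_lt_sum (fun j _ => ?_) ⟨i, Finset.mem_univ _, ?_⟩))
  · by_cases hj : hM.eigenvalues j < μ
    · gcongr
    · simp [hvK j (by simpa using hj)]
  · have hi' : hM.eigenvalues i < μ := by
      by_contra! hle
      exact hi (by simp [hvK i (by simpa using hle)])
    have : 0 < ‖(B *ᵥ v) i‖ ^ 2 := lt_of_le_of_ne (by positivity) (Ne.symm hi)
    gcongr

omit hM

lemma form_diagonal_add (D : n → ℕ) (A : Matrix n m ℂ) (v : n → ℂ) :
    (star v ⬝ᵥ (diagonal (fun i => (D i : ℂ)) + (2 : ℂ) • (A * Aᴴ)) *ᵥ v).re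
      = ∑ i, (D i : ℝ) * ‖v i‖ ^ 2 + 2 * normSqSum (Aᴴ *ᵥ v) := by
  have h1 := star_dotProduct_diagonal (fun i => (D i : ℝ)) v
  have h2 := star_dotProduct_conjTranspose_mul Aᴴ v
  rw [conjTranspose_conjTranspose] at h2
  simp only [Complex.ofReal_natCast] at h1
  rw [add_mulVec, dotProduct_add, h1, smul_mulVec, dotProduct_smul, h2, smul_eq_mul,
    Complex.add_re, Complex.ofReal_re, Complex.re_mul_ofReal]
  simp

lemma normSqSum_mulVec_of_diagonal {T : Matrix m n ℂ} {τ : n → ℝ}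
    (hT : Tᴴ * T = diagonal fun i => (τ i : ℂ)) (v : n → ℂ) :
    normSqSum (T *ᵥ v) = ∑ i, τ i * ‖v i‖ ^ 2 := by
  have h := star_dotProduct_conjTranspose_mul T v
  rw [hT, star_dotProduct_diagonal] at h
  exact_mod_cast h.symm

omit [DecidableEq n] in
-- This is `‖a‖² ≤ 2‖a + b‖² + 2‖b‖²`; the factor `2` on the right of the statement is the one in `2
-- A Aᴴ`.
lemma le_two_mul_normSqSum_add (a b : n → ℂ) :
    normSqSum a - 2 * normSqSum b ≤ 2 * normSqSum (a + b) := by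
  unfold normSqSum
  rw [Finset.mul_sum, Finset.mul_sum, ← Finset.sum_sub_distrib]
  refine Finset.sum_le_sum fun i _ => ?_
  have h : ‖a i‖ ≤ ‖(a + b) i‖ + ‖b i‖ := by
    calc ‖a i‖ = ‖(a + b) i - b i‖ := by simp
      _ ≤ _ := norm_sub_le _ _
  nlinarith [norm_nonneg (a i), sq_nonneg (‖(a + b) i‖ - ‖b i‖),
    mul_self_le_mul_self (norm_nonneg (a i)) h]

omit [DecidableEq n] in
lemma normSqSum_smul (c : ℝ) (v : n → ℂ) : normSqSum ((c : ℂ) • v) = c ^ 2 * normSqSum v := by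
  simp [normSqSum, Finset.mul_sum, mul_pow]

section PenaltyBounds

variable {D : n → ℕ} {T : Matrix m n ℂ} {τ : n → ℝ} {A : Matrix n m ℂ} {r e : ℝ}
  (hT : Tᴴ * T = diagonal fun i => (τ i : ℂ))
  (hE : ∑ i, ∑ j, ‖(Aᴴ - (r : ℂ) • T) i j‖ ^ 2 ≤ e)
include hT hE

/-- Vectors supported where `τ = 0` lie in the kernel of `T`, so only the remainder `Aᴴ - r T`, of
squared Frobenius norm at most `e`, contributes to the penalty. -/
lemma form_le_of_support {J : Finset n} {μ : ℝ} (hτ : ∀ i ∈ J, τ i = 0)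
    (hJ : ∀ i ∈ J, (D i : ℝ) + 2 * e ≤ μ) (v : n → ℂ) (hv : ∀ i ∉ J, v i = 0) :
    (star v ⬝ᵥ (diagonal (fun i => (D i : ℂ)) + (2 : ℂ) • (A * Aᴴ)) *ᵥ v).re
      ≤ μ * normSqSum v := by
  have hTv : T *ᵥ v = 0 := by
    by_contra h
    refine (normSqSum_pos h).ne' ?_
    rw [normSqSum_mulVec_of_diagonal hT]
    refine Finset.sum_eq_zero fun i _ => ?_
    by_cases hi : i ∈ J
    · simp [hτ i hi]
    · simp [hv i hi]
  have hA : Aᴴ *ᵥ v = (Aᴴ - (r : ℂ) • T) *ᵥ v := by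
    rw [sub_mulVec, smul_mulVec, hTv, smul_zero, sub_zero]
  have h1 : normSqSum (Aᴴ *ᵥ v) ≤ e * normSqSum v := by
    rw [hA]
    refine (normSqSum_mulVec_le _ v).trans ?_
    have : 0 ≤ normSqSum v := Finset.sum_nonneg fun _ _ => by positivity
    gcongr
  rw [form_diagonal_add]
  calc _ ≤ ∑ i, (D i : ℝ) * ‖v i‖ ^ 2 + 2 * (e * normSqSum v) := by gcongr
    _ = ∑ i, ((D i : ℝ) + 2 * e) * ‖v i‖ ^ 2 := by
        simp only [normSqSum, Finset.mul_sum, ← Finset.sum_add_distrib]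
        exact Finset.sum_congr rfl fun i _ => by ring
    _ ≤ _ := by
        rw [normSqSum, Finset.mul_sum]
        refine Finset.sum_le_sum fun i _ => ?_
        by_cases hi : i ∈ J
        · have := hJ i hi
          gcongr
        · simp [hv i hi]

lemma le_form_of_support {J : Finset n} {μ : ℝ}
    (hJ : ∀ i ∉ J, μ ≤ D i + r ^ 2 * τ i - 2 * e) (v : n → ℂ) (hv : ∀ i ∈ J, v i = 0) :
    μ * normSqSum v ≤
      (star v ⬝ᵥ (diagonal (fun i => (D i : ℂ)) + (2 : ℂ) • (A * Aᴴ)) *ᵥ v).re := by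
  have hA : Aᴴ *ᵥ v = (r : ℂ) • (T *ᵥ v) + (Aᴴ - (r : ℂ) • T) *ᵥ v := by
    rw [sub_mulVec, smul_mulVec]
    abel
  have h1 : normSqSum ((Aᴴ - (r : ℂ) • T) *ᵥ v) ≤ e * normSqSum v := by
    refine (normSqSum_mulVec_le _ v).trans ?_
    have : 0 ≤ normSqSum v := Finset.sum_nonneg fun _ _ => by positivity
    gcongr
  have h2 := le_two_mul_normSqSum_add ((r : ℂ) • (T *ᵥ v)) ((Aᴴ - (r : ℂ) • T) *ᵥ v)
  rw [← hA, normSqSum_smul, normSqSum_mulVec_of_diagonal hT] at h2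
  rw [form_diagonal_add]
  calc _ ≤ ∑ i, (D i + r ^ 2 * τ i - 2 * e) * ‖v i‖ ^ 2 := by
        rw [normSqSum, Finset.mul_sum]
        refine Finset.sum_le_sum fun i _ => ?_
        by_cases hi : i ∈ J
        · simp [hv i hi]
        · have := hJ i hi
          gcongr
    _ = ∑ i, (D i : ℝ) * ‖v i‖ ^ 2 + (r ^ 2 * ∑ i, τ i * ‖v i‖ ^ 2 - 2 * (e * normSqSum v)) := by
        simp only [normSqSum, Finset.mul_sum, ← Finset.sum_add_distrib, ← Finset.sum_sub_distrib]
        exact Finset.sum_congr rfl fun i _ => by ring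
    _ ≤ _ := by linarith

end PenaltyBounds

omit [DecidableEq n] in
/-- If `#{x ≤ k + δ} ≥ #{j ∈ V, D j ≤ k}` and `#{x < k - δ} ≤ #{j ∈ V, D j < k}` for all `k`, and
at most `#V` of the values `x` are below `R`, then these cluster around the integers `D j`,
`j ∈ V`, with the same multiplicities. -/
lemma count_clusters {x : n → ℝ} {D : n → ℕ} {V : Finset n} {N : ℕ} {δ ε R : ℝ}
    (hδ : 0 < δ) (hδε : δ < ε) (hδε' : δ + ε < 1) (hδR : N + 1 ≤ R) (hD : ∀ j, D j ≤ N)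
    (hle : ∀ k : ℕ, k ≤ N → (V.filter fun j => D j < k + 1).card ≤
      (Finset.univ.filter fun i => x i ≤ k + δ).card)
    (hge : ∀ k : ℕ, k ≤ N + 1 → (Finset.univ.filter fun i => x i < k - δ).card ≤
      (V.filter fun j => D j < k).card)
    (hgeR : (Finset.univ.filter fun i => x i < R).card ≤ V.card) :
    (∀ k : ℕ, k ≤ N → Nat.card {i // |x i - k| < ε} = (V.filter fun j => D j = k).card) ∧
    ∀ i, x i < R → ∃ k : ℕ, k ≤ N ∧ |x i - k| < ε := by
  have hVN : V.filter (fun j => D j < N + 1) = V :=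
    Finset.filter_true_of_mem fun j _ => Nat.lt_succ_of_le (hD j)
  have sub : ∀ k : ℕ, ∀ y : ℝ, k + δ < y → (Finset.univ.filter fun i => x i ≤ k + δ) ⊆
      Finset.univ.filter fun i => x i < y := fun k y hy i => by
    simp only [Finset.mem_filter, Finset.mem_univ, true_and]
    exact fun h => h.trans_lt hy
  -- Two nested sets with equally many elements coincide, so no value lies strictly between `k + δ`
  -- and `k + 1 - δ`.
  have gap : ∀ k : ℕ, k ≤ N → ∀ i, x i < (k + 1 : ℕ) - δ → x i ≤ k + δ := fun k hk i hi => by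
    have := Finset.eq_of_subset_of_card_le (sub k ((k + 1 : ℕ) - δ) (by push_cast; linarith))
      ((hge (k + 1) (by omega)).trans (hle k hk))
    have h2 : i ∈ Finset.univ.filter fun i => x i < (k + 1 : ℕ) - δ := by simpa using hi
    rw [← this] at h2
    simpa using h2
  have gapR : ∀ i, x i < R → x i ≤ N + δ := fun i hi => by
    have := Finset.eq_of_subset_of_card_le (sub N R (by linarith))
      (hgeR.trans (by have := hle N le_rfl; rwa [hVN] at this))
    have h2 : i ∈ Finset.univ.filter fun i => x i < R := by simpa using hi
    rw [← this] at h2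
    simpa using h2
  have low : ∀ i, -δ ≤ x i := fun i => by
    have := hge 0 (by omega)
    by_contra! h
    simp only [not_lt_zero, Finset.filter_false, Finset.card_empty, Nat.le_zero,
      Finset.card_eq_zero, Finset.filter_eq_empty_iff, Nat.cast_zero, zero_sub] at this
    exact this (Finset.mem_univ i) h
  have card_le' : ∀ k : ℕ, k ≤ N → (Finset.univ.filter fun i => x i ≤ k + δ).card =
      (V.filter fun j => D j < k + 1).card := fun k hk =>
    le_antisymm ((Finset.card_le_card (sub k ((k + 1 : ℕ) - δ) (by push_cast; linarith))).trans
      (hge (k + 1) (by omega))) (hle k hk)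
  have card_lt' : ∀ k : ℕ, k ≤ N → (Finset.univ.filter fun i => x i < k - δ).card =
      (V.filter fun j => D j < k).card := fun k hk => by
    refine le_antisymm (hge k (by omega)) ?_
    cases k with
    | zero => simp
    | succ k =>
      rw [← card_le' k (by omega)]
      exact Finset.card_le_card (sub k _ (by push_cast; linarith))
  -- Because `δ + ε < 1`, the `ε`-neighbourhood of `k` does not reach the clusters at `k ± 1`;
  -- because `δ < ε`, it contains the whole cluster at `k`.
  have key : ∀ k : ℕ, k ≤ N → ∀ i, |x i - k| < ε ↔ x i ≤ k + δ ∧ ¬ x i < k - δ := by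
    intro k hk i
    rw [abs_lt]
    constructor
    · rintro ⟨h1, h2⟩
      refine ⟨gap k hk i (by push_cast; linarith), fun h3 => ?_⟩
      cases k with
      | zero => have := low i; push_cast at h3; linarith
      | succ k => have := gap k (by omega) i h3; push_cast at h1; linarith
    · rintro ⟨h1, h2⟩
      constructor <;> linarith
  refine ⟨fun k hk => ?_, fun i hi => ?_⟩
  · rw [Nat.card_eq_fintype_card, Fintype.card_subtype]
    have h1 : (Finset.univ.filter fun i => x i < k - δ) ⊆
        Finset.univ.filter fun i => x i ≤ k + δ := fun i => by
      simp only [Finset.mem_filter, Finset.mem_univ, true_and]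
      intro h
      linarith
    have h2 : (V.filter fun j => D j < k) ⊆ V.filter fun j => D j < k + 1 :=
      Finset.monotone_filter_right _ fun j _ h => Nat.lt_succ_of_lt h
    classical
    have e1 : (Finset.univ.filter fun i => |x i - k| < ε) =
        (Finset.univ.filter fun i => x i ≤ k + δ) \ Finset.univ.filter fun i => x i < k - δ := by
      ext i
      simp [key k hk i]
    have e2 : (V.filter fun j => D j = k) =
        (V.filter fun j => D j < k + 1) \ V.filter fun j => D j < k := by
      ext j
      simp only [Finset.mem_filter, Finset.mem_sdiff]
      grind
    rw [e1, e2, Finset.card_sdiff_of_subset h1, Finset.card_sdiff_of_subset h2, card_le' k hk,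
      card_lt' k hk]
  · have hex : ∃ k : ℕ, x i ≤ k + δ := ⟨N, gapR i hi⟩
    classical
    have hk : Nat.find hex ≤ N := Nat.find_min' hex (gapR i hi)
    refine ⟨Nat.find hex, hk, (key _ hk i).mpr ⟨Nat.find_spec hex, fun h => ?_⟩⟩
    rcases hz : Nat.find hex with _ | k
    · rw [hz] at h
      have := low i
      push_cast at h
      linarith
    · rw [hz] at h hk
      exact Nat.find_min hex (m := k) (by omega) (gap k (by omega) i h)

/-- The eigenvalues of `D + 2 A Aᴴ`, where `Aᴴ = r T + o(1)` with `r → ∞`, cluster around those of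
`D` on the kernel of `T`, and the others go to infinity. -/
theorem eigenvalues_cluster {α : Type*} {F : Filter α} {D : n → ℕ} {N : ℕ} (hD : ∀ i, D i ≤ N)
    {T : Matrix m n ℂ} {τ : n → ℝ} (hT : Tᴴ * T = diagonal fun i => (τ i : ℂ))
    (hτ : ∀ i, τ i = 0 ∨ 1 ≤ τ i) {A : α → Matrix n m ℂ} {r : α → ℝ} (hr : Tendsto r F atTop)
    (hA : Tendsto (fun c => (A c)ᴴ - (r c : ℂ) • T) F (𝓝 0))
    {M : α → Matrix n n ℂ} (hM : ∀ c, (M c).IsHermitian)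
    (hMA : ∀ c, M c = diagonal (fun i => (D i : ℂ)) + (2 : ℂ) • (A c * (A c)ᴴ))
    {ε : ℝ} (hε : 0 < ε) (hε1 : ε < 1) (R : ℝ) :
    ∀ᶠ c in F,
      (∀ k : ℕ, k ≤ N → Nat.card {i // |(hM c).eigenvalues i - k| < ε} =
        (Finset.univ.filter fun i => τ i = 0 ∧ D i = k).card) ∧
      ∀ i, (hM c).eigenvalues i ≤ R → ∃ k : ℕ, k ≤ N ∧ |(hM c).eigenvalues i - k| < ε := by
  obtain ⟨δ, hδ0, hδε, hδε'⟩ : ∃ δ : ℝ, 0 < δ ∧ δ < ε ∧ δ + ε < 1 :=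
    ⟨min ε (1 - ε) / 2, by have := lt_min hε (sub_pos.mpr hε1); linarith,
      by have := min_le_left ε (1 - ε); linarith, by have := min_le_right ε (1 - ε); linarith⟩
  have hsum : Tendsto (fun c => ∑ i, ∑ j, ‖((A c)ᴴ - (r c : ℂ) • T) i j‖ ^ 2) F (𝓝 0) := by
    have : Tendsto (fun X : Matrix m n ℂ => ∑ i, ∑ j, ‖X i j‖ ^ 2) (𝓝 0) (𝓝 0) := by
      have hc : Continuous fun X : Matrix m n ℂ => ∑ i, ∑ j, ‖X i j‖ ^ 2 := by fun_prop
      simpa using hc.tendsto 0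
    exact this.comp hA
  -- The bound `R + 1` makes `x ≤ R` strict; the bound `N + 1` lets the penalized states be ignored
  -- in every count up to `N + 1`.
  set R' : ℝ := max (R + 1) (N + 1) with hR'
  -- The remainder is used with `e = δ / 2`, so that both form bounds shift by `2 * e = δ`.
  filter_upwards [hsum.eventually_le_const (show (0 : ℝ) < δ / 2 by positivity),
    hr.eventually_ge_atTop (R' + δ + 1)] with c hc hrc
  have hR'1 : (1 : ℝ) ≤ R' := (by simp : (1 : ℝ) ≤ N + 1).trans (le_max_right _ _)
  have hr2 : R' + δ ≤ r c ^ 2 := by nlinarith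
  have heig : ∀ (J : Finset n) (μ : ℝ),
      (∀ i ∉ J, μ ≤ D i + r c ^ 2 * τ i - δ) →
      (Finset.univ.filter fun i => (hM c).eigenvalues i < μ).card ≤ J.card := by
    intro J μ hJ
    refine card_eigenvalues_lt_le_card (hM c) J μ fun v hv => ?_
    rw [hMA c]
    refine le_form_of_support hT hc (fun i hi => (hJ i hi).trans (by linarith)) v hv
  have hlarge : ∀ i, τ i ≠ 0 → R' ≤ D i + r c ^ 2 * τ i - δ := fun i hi => by
    have h1 : 1 ≤ τ i := (hτ i).resolve_left hi
    have : (0 : ℝ) ≤ D i := by positivity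
    nlinarith [sq_nonneg (r c)]
  have hmain := count_clusters (x := (hM c).eigenvalues) (D := D)
    (V := Finset.univ.filter fun i => τ i = 0) (R := R') hδ0 hδε hδε' (le_max_right _ _) hD
    (fun k hk => by
      refine card_le_card_eigenvalues_le (hM c) _ _ fun v hv => ?_
      rw [hMA c]
      refine form_le_of_support hT hc (fun i hi => ?_) (fun i hi => ?_) v hv
      · simp only [Finset.mem_filter, Finset.mem_univ, true_and] at hi
        exact hi.1
      · simp only [Finset.mem_filter, Finset.mem_univ, true_and] at hi
        have : (D i : ℝ) ≤ k := by exact_mod_cast Nat.lt_succ_iff.mp hi.2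
        linarith)
    (fun k hk => by
      refine heig _ _ fun i hi => ?_
      simp only [Finset.mem_filter, Finset.mem_univ, true_and, not_and, not_lt] at hi
      by_cases h0 : τ i = 0
      · have : (k : ℝ) ≤ D i := by exact_mod_cast hi h0
        rw [h0]
        linarith
      · have h1 := hlarge i h0
        have h2 : (k : ℝ) ≤ N + 1 := by exact_mod_cast hk
        have := le_max_right (R + 1) (N + 1 : ℝ)
        linarith)
    (by
      refine heig _ _ fun i hi => ?_
      simp only [Finset.mem_filter, Finset.mem_univ, true_and] at hi
      exact hlarge i hi)
  refine ⟨fun k hk => ?_, fun i hi => hmain.2 i ?_⟩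
  · rw [hmain.1 k hk, Finset.filter_filter]
  · have := le_max_left (R + 1) (N + 1 : ℝ)
    linarith

end Spectrum

/-! ### Operators that shift the level, and the constraint from normal ordering. -/

section Operators

variable {S : ℕ}

@[simp] lemma opOf_ket (v : State S → Vec S) (s : State S) : opOf v (ket s) = v s := by
  simp [opOf, ket]

@[simp] lemma diagOp_ket (w : State S → ℝ) (s : State S) :
    diagOp w (ket s) = (w s : ℂ) • ket s := by
  simp [diagOp]

lemma ket_apply_ne_zero {s t : State S} (h : ket s t ≠ 0) : t = s := by
  by_contra hne
  exact h (Finsupp.single_eq_of_ne hne)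

lemma smul_ket_apply_ne_zero {c : ℂ} {s t : State S} (h : (c • ket s) t ≠ 0) : c ≠ 0 ∧ t = s := by
  rw [Finsupp.smul_apply, smul_eq_mul] at h
  exact ⟨left_ne_zero_of_mul h, ket_apply_ne_zero (right_ne_zero_of_mul h)⟩

/-- The matrix elements of a product of operators. -/
lemma mul_ket_apply (A B : Op S) (s t : State S) {F : Finset (State S)}
    (hF : (B (ket s)).support ⊆ F) :
    (A * B) (ket s) t = ∑ u ∈ F, B (ket s) u * A (ket u) t := by
  have h : B (ket s) = ∑ u ∈ F, B (ket s) u • ket u := by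
    conv_lhs => rw [← Finsupp.sum_single (B (ket s)),
      Finsupp.sum_of_support_subset _ hF _ (by simp)]
    simp [ket]
  rw [Module.End.mul_apply]
  conv_lhs => rw [h]
  simp [Finsupp.finsetSum_apply]

lemma exists_of_mul_ket_apply_ne_zero {A B : Op S} {s t : State S}
    (h : (A * B) (ket s) t ≠ 0) : ∃ u, B (ket s) u ≠ 0 ∧ A (ket u) t ≠ 0 := by
  rw [mul_ket_apply A B s t subset_rfl] at h
  obtain ⟨u, -, hu⟩ := Finset.exists_ne_zero_of_sum_ne_zero h
  exact ⟨u, left_ne_zero_of_mul hu, right_ne_zero_of_mul hu⟩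

/-! ### Operators that shift `L₀⁽²⁾` -/

lemma levelL0_add_single (n : Occ) (k : Mode) :
    levelL0 (n + Finsupp.single k 1) = levelL0 n + k.1.natAbs := by
  unfold levelL0
  rw [Finsupp.sum_add_index' (by simp) (by intros; ring)]
  simp

/-- `T` changes `L₀⁽²⁾` by `k`. -/
def Shifts (T : Op S) (k : ℤ) : Prop :=
  ∀ s t, T (ket s) t ≠ 0 → (levelL0 t.1 : ℤ) = levelL0 s.1 + k

namespace Shifts

variable {A B : Op S} {j k : ℤ}

lemma zero (k : ℤ) : Shifts (0 : Op S) k := fun _ _ h => absurd rfl h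

lemma one : Shifts (1 : Op S) 0 := fun s t h => by
  rw [ket_apply_ne_zero (s := s) (t := t) h, add_zero]

lemma mul (hA : Shifts A j) (hB : Shifts B k) : Shifts (A * B) (j + k) := fun s t h => by
  obtain ⟨u, hu, hu'⟩ := exists_of_mul_ket_apply_ne_zero h
  rw [hA u t hu', hB s u hu]
  ring

lemma pow (hA : Shifts A k) (n : ℕ) : Shifts (A ^ n) (n * k) := by
  induction n with
  | zero => simpa using one
  | succ n ih =>
    rw [pow_succ]
    convert ih.mul hA using 1
    push_cast
    ring

lemma smul (hA : Shifts A k) (c : ℂ) : Shifts (c • A) k := fun s t h =>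
  hA s t (right_ne_zero_of_mul (a := c) (by simpa using h))

lemma sumOp {ι : Type} {T : ι → Op S} (hT : ∀ i, Shifts (T i) k) :
    Shifts (LightConeString.sumOp T) k := by
  intro s
  rw [LightConeString.sumOp, opOf_ket]
  -- The induction also covers the default value `0` of a `finsum` with infinite support.
  refine finsum_induction (fun v : Vec S => ∀ t, v t ≠ 0 → (levelL0 t.1 : ℤ) = levelL0 s.1 + k)
    (fun t h => absurd rfl h) (fun v w hv hw t h => ?_) fun i => hT i s
  by_cases h' : v t = 0
  · exact hw t fun h'' => h (by simp [h', h''])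
  · exact hv t h'

lemma diagOp (w : State S → ℝ) : Shifts (LightConeString.diagOp w) 0 := fun s t h => by
  rw [diagOp_ket] at h
  rw [(smul_ket_apply_ne_zero h).2, add_zero]

lemma removeQuantum (k : Mode) : Shifts (removeQuantum S k) (-(k.1.natAbs : ℤ)) := fun s t h => by
  rw [LightConeString.removeQuantum, opOf_ket] at h
  obtain ⟨h1, rfl⟩ := smul_ket_apply_ne_zero h
  -- In an empty mode the truncated subtraction would not lower the level, but there the coefficient
  -- `√0` kills the vector.
  have hk : 1 ≤ s.1 k := by
    by_contra! h0
    simp [show s.1 k = 0 by omega] at h1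
  have hs : s.1 - Finsupp.single k 1 + Finsupp.single k 1 = s.1 :=
    tsub_add_cancel_of_le (Finsupp.single_le_iff.mpr hk)
  have := levelL0_add_single (s.1 - Finsupp.single k 1) k
  rw [hs] at this
  rw [this]
  push_cast
  ring

lemma addQuantum (k : Mode) : Shifts (addQuantum S k) k.1.natAbs := fun s t h => by
  rw [LightConeString.addQuantum, opOf_ket] at h
  rw [(smul_ket_apply_ne_zero h).2, levelL0_add_single]
  push_cast
  ring

lemma osc (k : ℤ) : Shifts (osc S k) (-k) := by
  unfold LightConeString.osc
  split_ifs with h h'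
  · convert removeQuantum _ using 1
    simp [abs_of_pos h']
  · convert addQuantum _ using 1
    simp [abs_of_nonpos (not_lt.mp h')]
  · exact zero _

lemma oscAdj (k : ℤ) : Shifts (oscAdj S k) k := by
  unfold LightConeString.oscAdj
  split_ifs with h h'
  · convert addQuantum _ using 1
    simp [abs_of_pos h']
  · convert removeQuantum _ using 1
    simp [abs_of_nonpos (not_lt.mp h')]
  · exact zero _

lemma of_eq (hA : Shifts A j) (h : j = k) : Shifts A k := h ▸ hA

lemma spinPlus : Shifts (spinPlus S) 0 := fun s t h => by
  rw [LightConeString.spinPlus, opOf_ket] at h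
  split_ifs at h with hs
  · rw [(smul_ket_apply_ne_zero h).2, add_zero]
  · exact absurd rfl h

lemma spinMinus : Shifts (spinMinus S) 0 := fun s t h => by
  rw [LightConeString.spinMinus, opOf_ket] at h
  split_ifs at h with hs
  · rw [(smul_ket_apply_ne_zero h).2, add_zero]
  · exact absurd rfl h

end Shifts

/-- The amount by which a raising elementary variable changes `L₀⁽²⁾`. -/
def Family.step : Family → ℕ
  | .a1 => 1
  | .dPlus => 4
  | .dMinus => 4
  | _ => 2

/-- The amount by which an elementary variable changes `L₀⁽²⁾`. -/
def Var.step : Var → ℤ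
  | .up x => x.step
  | .down x => -x.step
  | _ => 0

lemma Family.one_le_step (x : Family) : 1 ≤ x.step := by cases x <;> simp [Family.step]

lemma shifts_varOp (c₂ : ℝ) (x : Var) : Shifts (varOp S c₂ x) x.step := by
  cases x with
  | up x =>
    cases x with
    | a1 => exact Shifts.oscAdj 1
    | dPlus => exact (Shifts.oscAdj 4).smul _
    | dMinus => exact (Shifts.osc (-4)).smul _
    | fPlus => exact Shifts.sumOp fun k =>
        (((Shifts.oscAdj _).mul (Shifts.osc _)).smul _).of_eq (by simp [Var.step, Family.step])
    | fMinus => exact Shifts.sumOp fun k =>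
        (((Shifts.oscAdj _).mul (Shifts.osc _)).smul _).of_eq (by
          simp only [Var.step, Family.step]; ring)
    | gPlus => exact Shifts.sumOp fun k =>
        (((Shifts.osc _).mul (Shifts.osc _)).smul _).of_eq (by simp [Var.step, Family.step])
    | gMinus => exact Shifts.sumOp fun k =>
        (((Shifts.oscAdj _).mul (Shifts.oscAdj _)).smul _).of_eq (by simp [Var.step, Family.step])
  | down x =>
    cases x with
    | a1 => exact Shifts.osc 1
    | dPlus => exact (Shifts.osc 4).smul _
    | dMinus => exact (Shifts.oscAdj (-4)).smul _
    | fPlus => exact Shifts.sumOp fun k =>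
        (((Shifts.oscAdj _).mul (Shifts.osc _)).smul _).of_eq (by simp [Var.step, Family.step])
    | fMinus => exact Shifts.sumOp fun k =>
        (((Shifts.oscAdj _).mul (Shifts.osc _)).smul _).of_eq (by
          simp only [Var.step, Family.step]; ring)
    | gPlus => exact Shifts.sumOp fun k =>
        (((Shifts.oscAdj _).mul (Shifts.oscAdj _)).smul _).of_eq (by simp [Var.step, Family.step])
    | gMinus => exact Shifts.sumOp fun k =>
        (((Shifts.osc _).mul (Shifts.osc _)).smul _).of_eq (by
          simp only [Var.step, Family.step]; push_cast; ring)
  | sigmaPlus => exact Shifts.sumOp fun p =>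
    ((((Shifts.oscAdj _).mul (Shifts.oscAdj _)).mul (Shifts.osc _)).smul _).of_eq (by simp [Var.step])
  | sigmaMinus => exact Shifts.sumOp fun p =>
    ((((Shifts.oscAdj _).mul (Shifts.osc _)).mul (Shifts.osc _)).smul _).of_eq (by simp [Var.step])
  | sPlus => exact Shifts.spinPlus
  | sMinus => exact Shifts.spinMinus
  | gam => exact Shifts.diagOp _
  | gamInv => exact Shifts.diagOp _

/-- The operator of a monomial, ordered as prescribed by `l`. -/
noncomputable def monomialOp (l : List Var) (S : ℕ) (c₂ : ℝ) (m : Var → ℕ) : Op S :=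
  (l.map fun x => varOp S c₂ x ^ m x).prod

/-- `1` for raising variables. -/
def Var.ups : Var → ℕ
  | .up _ => 1
  | _ => 0

/-- `1` for lowering variables. -/
def Var.downs : Var → ℕ
  | .down _ => 1
  | _ => 0

/-- Levels are nonnegative and each ladder factor moves the level by at least `1`. The third
conjunct serves the induction: a tail of lowering factors alone brings the level down by at least
their number. -/
lemma monomialOp_apply_ne_zero {l : List Var} (hl : l.Pairwise fun x y => x.grade ≤ y.grade)
    {c₂ : ℝ} {m : Var → ℕ} {s t : State S} (h : monomialOp l S c₂ m (ket s) t ≠ 0) :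
    (l.map fun x => m x * x.ups).sum ≤ levelL0 t.1 ∧
      (l.map fun x => m x * x.downs).sum ≤ levelL0 s.1 ∧
      ((∀ x ∈ l, x.grade = 2) →
        levelL0 t.1 + (l.map fun x => m x * x.downs).sum ≤ levelL0 s.1) := by
  induction l generalizing t with
  | nil =>
    have := ket_apply_ne_zero (s := s) (t := t) h
    simp [this]
  | cons x l ih =>
    rw [List.pairwise_cons] at hl
    simp only [monomialOp, List.map_cons, List.prod_cons] at h
    obtain ⟨u, hu, hu'⟩ := exists_of_mul_ket_apply_ne_zero h
    obtain ⟨h1, h2, h3⟩ := ih hl.2 hu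
    have hx := (shifts_varOp c₂ x).pow (m x) u t hu'
    simp only [List.map_cons, List.sum_cons, List.forall_mem_cons]
    cases x with
    | up y =>
      have := Nat.mul_le_mul_left (m (.up y)) y.one_le_step
      simp only [Var.step] at hx
      norm_cast at hx
      refine ⟨?_, ?_, by simp [Var.grade]⟩
      · simp only [show (Var.up y).ups = 1 from rfl]; omega
      · simp only [show (Var.up y).downs = 0 from rfl]; omega
    | down y =>
      have := Nat.mul_le_mul_left (m (.down y)) y.one_le_step
      -- A lowering factor has maximal grade, so everything to its right is lowering too.
      have hall : ∀ z ∈ l, z.grade = 2 := fun z hz => by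
        have := hl.1 z hz
        have h4 : z.grade ≤ 2 := by cases z <;> simp [Var.grade]
        simp only [Var.grade] at this h4 ⊢
        omega
      have h4 := h3 hall
      have h5 : (l.map fun x => m x * x.ups).sum = 0 := by
        refine List.sum_eq_zero fun a ha => ?_
        obtain ⟨z, hz, rfl⟩ := List.mem_map.mp ha
        have := hall z hz
        cases z <;> simp_all [Var.grade, Var.ups]
      simp only [Var.step, mul_neg] at hx
      have hx' : levelL0 t.1 + m (.down y) * y.step = levelL0 u.1 := by zify; linarith
      simp only [show (Var.down y).ups = 0 from rfl, show (Var.down y).downs = 1 from rfl]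
      refine ⟨by omega, by omega, fun _ => by omega⟩
    | _ =>
      simp only [Var.step, mul_zero, add_zero, Nat.cast_inj] at hx
      refine ⟨?_, ?_, by simp [Var.grade]⟩
      · rw [hx]
        exact (Nat.zero_add _).le.trans h1
      · exact (Nat.zero_add _).le.trans h2

end Operators

/-! ### Power counting in the recursion for `P_n` and `b_n`. -/

section Weights

/-- `1` for the elementary variables that change `L₀⁽²⁾`. -/
def Var.ladder : Var → ℤ
  | .up _ => 1
  | .down _ => 1
  | _ => 0

/-- The exponent of `γ⁻¹`. -/
def Var.gamDeg : Var → ℤ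
  | .gamInv => 1
  | .gam => -1
  | _ => 0

lemma Var.conj_conj (x : Var) : x.conj.conj = x := by cases x <;> rfl

lemma Var.conj_injective : Function.Injective Var.conj :=
  (show Function.Involutive Var.conj from Var.conj_conj).injective

/-- Every monomial of `p` has at least `a` factors that change `L₀⁽²⁾`, and at most the power
`b / 2` of `γ⁻¹`. -/
def WeightBound (a b : ℤ) (p : ClassicalExpr) : Prop :=
  ∀ m ∈ p.support, a ≤ Finsupp.weight Var.ladder m ∧ 2 * Finsupp.weight Var.gamDeg m ≤ b

namespace WeightBound

variable {a b a' b' : ℤ} {p q : ClassicalExpr}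

lemma mono (hp : WeightBound a b p) (ha : a' ≤ a) (hb : b ≤ b') : WeightBound a' b' p :=
  fun m hm => ⟨ha.trans (hp m hm).1, (hp m hm).2.trans hb⟩

lemma zero (a b : ℤ) : WeightBound a b 0 := fun m hm => by simp at hm

lemma C (c : ℝ) : WeightBound 0 0 (.C c) := fun m hm => by
  classical
  rw [← MvPolynomial.monomial_zero'] at hm
  have := Finset.mem_singleton.mp (MvPolynomial.support_monomial_subset hm)
  simp [this]

lemma X (x : Var) : WeightBound x.ladder (2 * x.gamDeg) (.X x) := fun m hm => by
  rw [MvPolynomial.support_X, Finset.mem_singleton] at hm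
  simp [hm, Finsupp.weight_single]

lemma add (hp : WeightBound a b p) (hq : WeightBound a b q) : WeightBound a b (p + q) := by
  classical
  exact fun m hm => (Finset.mem_union.mp (MvPolynomial.support_add hm)).elim (hp m) (hq m)

lemma neg (hp : WeightBound a b p) : WeightBound a b (-p) := fun m hm =>
  hp m (by rwa [MvPolynomial.support_neg] at hm)

lemma sub (hp : WeightBound a b p) (hq : WeightBound a b q) : WeightBound a b (p - q) :=
  sub_eq_add_neg p q ▸ hp.add hq.neg

lemma mul (hp : WeightBound a b p) (hq : WeightBound a' b' q) :
    WeightBound (a + a') (b + b') (p * q) := by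
  classical
  intro m hm
  obtain ⟨m₁, h₁, m₂, h₂, rfl⟩ := Finset.mem_add.mp (MvPolynomial.support_mul p q hm)
  have := hp m₁ h₁
  have := hq m₂ h₂
  simp only [map_add]
  constructor <;> linarith

lemma pow (hp : WeightBound a b p) (n : ℕ) : WeightBound (n * a) (n * b) (p ^ n) := by
  induction n with
  | zero => simpa using C 1
  | succ n ih =>
    rw [pow_succ]
    exact (ih.mul hp).mono (by push_cast; linarith) (by push_cast; linarith)

lemma sum {ι : Type*} {s : Finset ι} {f : ι → ClassicalExpr}
    (hf : ∀ i ∈ s, WeightBound a b (f i)) : WeightBound a b (∑ i ∈ s, f i) :=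
  Finset.sum_induction _ _ (fun _ _ => add) (zero a b) hf

lemma conj (hp : WeightBound a b p) : WeightBound a b (conj p) := by
  classical
  intro m hm
  rw [LightConeString.conj, MvPolynomial.support_rename_of_injective Var.conj_injective,
    Finset.mem_image] at hm
  obtain ⟨m, hm, rfl⟩ := hm
  have h : ∀ w : Var → ℤ, (∀ x, w x.conj = w x) →
      Finsupp.weight w (Finsupp.mapDomain Var.conj m) = Finsupp.weight w m := fun w hw => by
    rw [Finsupp.weight_apply, Finsupp.weight_apply,
      Finsupp.sum_mapDomain_index (by simp) (by intros; ring)]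
    simp [hw]
  rw [h _ (fun x => by cases x <;> rfl), h _ (fun x => by cases x <;> rfl)]
  exact hp m hm

lemma of_symA : WeightBound 1 0 symA := X _
lemma of_symD : WeightBound 1 0 symD := (X (.up .dPlus)).sub (X (.down .dMinus))
lemma of_symF : WeightBound 1 0 symF := (X (.up .fPlus)).sub (X (.down .fMinus))
lemma of_symG : WeightBound 1 0 symG := (X (.down .gMinus)).sub (X (.up .gPlus))
lemma of_symS : WeightBound 0 2 symS := (X .sPlus).mul (X .gamInv)
lemma of_symGamSq : WeightBound 0 (-4) symGamSq := (X .gam).pow 2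

end WeightBound

-- The bounds reproduce themselves: the terms with `d` attain the exponent `n + 1` for `P_n`, the
-- term `γ² P* P` attains `n - 2` for `b_n`, and the ladder bounds are attained by `S₊ b / γ` and by
-- `b b`. Exponents of `γ⁻¹` are doubled because they grow by one half per step.
open WeightBound in
lemma weightBound_expansionPair (n : ℕ) (hn : 1 ≤ n) :
    WeightBound (n - 1) (n + 1) (expansionPair n).1 ∧
      WeightBound n (n - 2) (expansionPair n).2 := by
  induction n using Nat.strong_induction_on with
  | _ n ih =>
  match n, hn with
  | 1, _ =>
    rw [expansionPair]
    exact ⟨((X .sigmaPlus).neg.mono (by simp [Var.ladder]) (by simp [Var.gamDeg])).add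
      (of_symS.mono (by simp) (by simp)), zero _ _⟩
  | n + 2, _ =>
    rw [expansionPair]
    have h1 := ih (n + 1) (by omega) (by omega)
    have l1 : ∀ m : Fin n, ((n - (m : ℕ) : ℕ) : ℤ) = n - m := fun m =>
      Nat.cast_sub m.2.le
    have l2 : ∀ m : Fin (n + 1), ((n + 1 - (m : ℕ) : ℕ) : ℤ) = n + 1 - m := fun m => by
      rw [Nat.cast_sub m.2.le]; push_cast; ring
    have i1 : ∀ m : Fin n, _ := fun m => ih (n - m) (by omega) (by omega)
    have i2 : ∀ m : Fin n, _ := fun m => ih (m + 1) (by omega) (by omega)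
    have i3 : ∀ m : Fin (n + 1), _ := fun m => ih (n + 1 - m) (by omega) (by omega)
    have i4 : ∀ m : Fin (n + 1), _ := fun m => ih (m + 1) (by omega) (by omega)
    constructor
    · refine ((((?_ : WeightBound _ _ _).sub ?_).sub ?_).sub ?_).add ?_
      · exact ((of_symF.conj.mul (of_symA.conj.pow 2)).mul h1.1.conj).neg.mono
          (by push_cast; linarith) (by push_cast; linarith)
      · exact ((of_symG.conj.mul (of_symA.pow 2)).mul h1.1).mono
          (by push_cast; linarith) (by push_cast; linarith)
      · exact ((of_symD.conj.mul (of_symA.conj.pow 4)).mul (sum (a := n - 1) (b := n + 3) fun m _ =>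
          ((i1 m).1.conj.mul (i2 m).1.conj).mono (by rw [l1]; push_cast; linarith)
            (by rw [l1]; push_cast; linarith))).mono
          (by push_cast; linarith) (by push_cast; linarith)
      · exact ((((C _).mul of_symD).mul (of_symA.conj.pow 2)).mul (of_symA.pow 2) |>.mul
          (sum (a := n - 1) (b := n + 3) fun m _ =>
          ((i1 m).1.mul (i2 m).1.conj).mono (by rw [l1]; push_cast; linarith)
            (by rw [l1]; push_cast; linarith))).mono
          (by push_cast; linarith) (by push_cast; linarith)
      · exact (of_symS.mul h1.2).mono (by push_cast; linarith) (by push_cast; linarith)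
    · refine WeightBound.sub ?_ ?_
      · exact (((of_symA.conj.pow 2).mul (of_symA.pow 2)).mul of_symGamSq |>.mul
          (sum (a := n) (b := n + 4) fun m _ =>
          ((i3 m).1.conj.mul (i4 m).1).mono (by rw [l2]; push_cast; linarith)
            (by rw [l2]; push_cast; linarith))).mono
          (by push_cast; linarith) (by push_cast; linarith)
      · exact ((C _).mul (sum (a := n + 2) (b := n - 2) fun m _ =>
          ((i3 m).2.mul (i4 m).2).mono (by rw [l2]; push_cast; linarith)
            (by rw [l2]; push_cast; linarith))).mono
          (by push_cast; linarith) (by push_cast; linarith)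

lemma weight_eq_list_sum {l : List Var} (hl : IsNormalOrder l) (w : Var → ℤ) (m : Var →₀ ℕ) :
    Finsupp.weight w m = (l.map fun x => (m x : ℤ) * w x).sum := by
  classical
  rw [Finsupp.weight_apply, Finsupp.sum_of_support_subset (s := l.toFinset) _
    (fun x _ => List.mem_toFinset.mpr (hl.mem x)) _ (by simp),
    ← List.sum_toFinset _ hl.nodup]
  simp

end Weights

/-! ### Vanishing matrix elements of `:P_n:`, and the leading symbol `S₊ / γ`. -/

section NormalOrder

variable {l : List Var} {S : ℕ}

lemma normalOrder_apply (l : List Var) (S : ℕ) (c₂ : ℝ) (p : ClassicalExpr) :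
    normalOrder l S c₂ p = ∑ m ∈ p.support, p.coeff m • monomialOp l S c₂ m := by
  rw [normalOrder, Module.Basis.constr_apply]
  rfl

lemma normalOrder_apply_eq_zero (hl : IsNormalOrder l) {c₂ : ℝ} {p : ClassicalExpr} {a b : ℤ}
    (hp : WeightBound a b p) {s t : State S} (hst : (levelL0 s.1 : ℤ) + levelL0 t.1 < a) :
    normalOrder l S c₂ p (ket s) t = 0 := by
  rw [normalOrder_apply, LinearMap.sum_apply, Finsupp.finsetSum_apply]
  refine Finset.sum_eq_zero fun m hm => ?_
  by_contra hne
  have hne' : monomialOp l S c₂ m (ket s) t ≠ 0 := fun h => hne (by simp [h])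
  obtain ⟨h1, h2, -⟩ := monomialOp_apply_ne_zero hl.grade hne'
  have h3 := (hp m hm).1
  rw [weight_eq_list_sum hl] at h3
  have h4 : (l.map fun x => (m x : ℤ) * x.ladder).sum =
      (((l.map fun x => m x * x.ups).sum + (l.map fun x => m x * x.downs).sum : ℕ) : ℤ) := by
    rw [← List.sum_map_add, Nat.cast_list_sum, List.map_map]
    congr 1
    refine List.map_congr_left fun x _ => ?_
    cases x <;> simp [Var.ladder, Var.ups, Var.downs]
  rw [h4] at h3
  omega

/-- Commutation is needed because a normal ordering leaves the relative position of the neutral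
factors `S₊` and `γ⁻¹` open. -/
lemma prod_map_eq_mul {ι M : Type*} [Monoid M] [DecidableEq ι] (l : List ι) (f : ι → M) {x y : ι}
    (hxy : x ≠ y) (hf : ∀ z, z ≠ x → z ≠ y → f z = 1) (hc : Commute (f x) (f y)) :
    (l.map f).prod = f x ^ l.count x * f y ^ l.count y := by
  induction l with
  | nil => simp
  | cons z l ih =>
    rw [List.map_cons, List.prod_cons, ih]
    by_cases hx : z = x
    · subst hx
      rw [List.count_cons_self, List.count_cons_of_ne hxy, pow_succ', mul_assoc]
    by_cases hy : z = y
    · subst hy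
      rw [List.count_cons_self, List.count_cons_of_ne hx, pow_succ', ← mul_assoc, ← mul_assoc,
        (hc.symm.pow_right _).eq]
    · rw [List.count_cons_of_ne hx, List.count_cons_of_ne hy, hf z hx hy, one_mul]

lemma diagOp_apply (w : State S → ℝ) (v : Vec S) (t : State S) :
    diagOp w v t = w t * v t := by
  induction v using Finsupp.induction_linear with
  | zero => simp
  | add v v' h h' => simp [h, h', mul_add]
  | single s c =>
    have : Finsupp.single s c = c • ket s := by simp [ket]
    rw [this, map_smul, diagOp_ket]
    by_cases hst : ket s t = 0
    · simp [hst]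
    · rw [ket_apply_ne_zero hst]
      simp
      ring

lemma spinPlus_commute_gamInv (c₂ : ℝ) :
    Commute (varOp S c₂ .sPlus) (varOp S c₂ .gamInv) := by
  refine Finsupp.lhom_ext' fun s => LinearMap.ext_ring ?_
  change spinPlus S (diagOp _ (ket s)) = diagOp _ (spinPlus S (ket s))
  rw [diagOp_ket, map_smul, spinPlus, opOf_ket]
  split_ifs
  · rw [map_smul, diagOp_ket, smul_comm]
  · simp

lemma normalOrder_symS (hl : IsNormalOrder l) (c₂ : ℝ) :
    normalOrder l S c₂ symS = varOp S c₂ .sPlus * varOp S c₂ .gamInv := by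
  classical
  have h : symS = MvPolynomial.basisMonomials Var ℝ
      (Finsupp.single .sPlus 1 + Finsupp.single .gamInv 1) := by
    simp [symS, MvPolynomial.X, MvPolynomial.monomial_mul]
  rw [normalOrder, h, Module.Basis.constr_basis,
    prod_map_eq_mul l _ (x := .sPlus) (y := .gamInv) (by simp) ?_ ?_,
    List.count_eq_one_of_mem hl.nodup (hl.mem _), List.count_eq_one_of_mem hl.nodup (hl.mem _)]
  · simp
  · intro z h1 h2
    simp [h1.symm, h2.symm]
  · exact (spinPlus_commute_gamInv c₂).pow_pow _ _

end NormalOrder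

open Asymptotics

/-! ### Consequences of `1 ≪ c₁² ≪ c₂ ≪ c₁⁴`. -/

section Limit

lemma tendsto_sq_fst : Tendsto (fun c : ℝ × ℝ => c.1 ^ 2) heavyVacuumLimit atTop :=
  tendsto_comap.mono_left (inf_le_left.trans (inf_le_left.trans inf_le_left))

lemma tendsto_heavy_snd_div : Tendsto (fun c : ℝ × ℝ => c.2 / c.1 ^ 2) heavyVacuumLimit atTop :=
  tendsto_comap.mono_left (inf_le_left.trans (inf_le_left.trans inf_le_right))

lemma tendsto_pow_div : Tendsto (fun c : ℝ × ℝ => c.1 ^ 4 / c.2) heavyVacuumLimit atTop :=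
  tendsto_comap.mono_left (inf_le_left.trans inf_le_right)

lemma eventually_fst_pos : ∀ᶠ c : ℝ × ℝ in heavyVacuumLimit, 0 < c.1 :=
  mem_inf_of_right (mem_principal_self _)

lemma tendsto_heavy_fst : Tendsto (fun c : ℝ × ℝ => c.1) heavyVacuumLimit atTop := by
  refine (Real.tendsto_sqrt_atTop.comp tendsto_sq_fst).congr' ?_
  filter_upwards [eventually_fst_pos] with c hc
  simp [Real.sqrt_sq hc.le]

lemma tendsto_heavy_snd : Tendsto (fun c : ℝ × ℝ => c.2) heavyVacuumLimit atTop := by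
  refine (tendsto_heavy_snd_div.atTop_mul_atTop₀ tendsto_sq_fst).congr' ?_
  filter_upwards [eventually_fst_pos] with c hc
  field_simp

lemma tendsto_sqrt_snd : Tendsto (fun c : ℝ × ℝ => √c.2) heavyVacuumLimit atTop :=
  Real.tendsto_sqrt_atTop.comp tendsto_heavy_snd

lemma tendsto_sqrt_snd_div_fst :
    Tendsto (fun c : ℝ × ℝ => √c.2 / c.1) heavyVacuumLimit atTop := by
  refine (Real.tendsto_sqrt_atTop.comp tendsto_heavy_snd_div).congr' ?_
  filter_upwards [eventually_fst_pos, tendsto_heavy_snd.eventually_ge_atTop 0] with c hc hc2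
  simp [Real.sqrt_div hc2, Real.sqrt_sq hc.le]

lemma tendsto_sqrt_snd_div_sq :
    Tendsto (fun c : ℝ × ℝ => √c.2 / c.1 ^ 2) heavyVacuumLimit (𝓝 0) := by
  refine (tendsto_inv_atTop_zero.comp (Real.tendsto_sqrt_atTop.comp tendsto_pow_div)).congr' ?_
  filter_upwards [eventually_fst_pos, tendsto_heavy_snd.eventually_ge_atTop 0] with c hc hc2
  have h4 : c.1 ^ 4 = (c.1 ^ 2) ^ 2 := by ring
  simp [Real.sqrt_div' _ hc2, h4, Real.sqrt_sq (sq_nonneg c.1)]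

end Limit

/-! ### Growth of matrix elements in powers of `√c₂`. -/

section Controlled

variable {S : ℕ}

/-- The matrix elements of `T c` are supported near the diagonal, independently of `c`, and are
of the order of `g c`. -/
def Controlled (T : ℝ × ℝ → Op S) (g : ℝ × ℝ → ℝ) : Prop :=
  ∀ s, ∃ F : Finset (State S), (∀ c, (T c (ket s)).support ⊆ F) ∧
    ∀ t, (fun c => T c (ket s) t) =O[heavyVacuumLimit] g

namespace Controlled

variable {A B : ℝ × ℝ → Op S} {g h : ℝ × ℝ → ℝ}

lemma const (A : Op S) : Controlled (fun _ => A) fun _ => 1 := fun s =>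
  ⟨(A (ket s)).support, fun _ => subset_rfl, fun _ => isBigO_const_const _ one_ne_zero _⟩

/-- The intermediate states range over a finite set independent of `c`, so the entrywise bounds
multiply. -/
lemma mul (hA : Controlled A g) (hB : Controlled B h) :
    Controlled (fun c => A c * B c) fun c => g c * h c := by
  classical
  intro s
  obtain ⟨F, hF, hF'⟩ := hB s
  choose G hG hG' using hA
  have heq : ∀ c t, (A c * B c) (ket s) t = ∑ u ∈ F, B c (ket s) u * A c (ket u) t :=
    fun c t => mul_ket_apply _ _ _ _ (hF c)
  refine ⟨F.biUnion G, fun c t ht => ?_, fun t => ?_⟩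
  · rw [Finsupp.mem_support_iff, heq] at ht
    obtain ⟨u, hu, hne⟩ := Finset.exists_ne_zero_of_sum_ne_zero ht
    exact Finset.mem_biUnion.mpr ⟨u, hu, hG u c
      (Finsupp.mem_support_iff.mpr (right_ne_zero_of_mul hne))⟩
  · simp only [heq]
    refine IsBigO.fun_sum fun u _ => ?_
    exact ((hF' u).mul (hG' u t)).congr_right fun c => mul_comm _ _

lemma congr (hA : Controlled A g) (hgh : g =ᶠ[heavyVacuumLimit] h) : Controlled A h := fun s => by
  obtain ⟨F, hF, hF'⟩ := hA s
  exact ⟨F, hF, fun t => (hF' t).congr' .rfl hgh⟩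

lemma pow (hA : Controlled A g) (n : ℕ) : Controlled (fun c => A c ^ n) fun c => g c ^ n := by
  induction n with
  | zero => simpa using const (1 : Op S)
  | succ n ih => simpa only [pow_succ] using ih.mul hA

lemma diagOp {w : ℝ × ℝ → State S → ℝ} (hw : ∀ s, (fun c => w c s) =O[heavyVacuumLimit] g) :
    Controlled (fun c => diagOp (w c)) g := fun s => by
  refine ⟨{s}, fun c t ht => ?_, fun t => ?_⟩
  · rw [Finsupp.mem_support_iff, diagOp_ket] at ht
    exact Finset.mem_singleton.mpr (smul_ket_apply_ne_zero ht).2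
  · simp only [diagOp_ket, Finsupp.smul_apply, smul_eq_mul]
    have : (fun c => ((w c s : ℝ) : ℂ)) =O[heavyVacuumLimit] g :=
      (IsBigO.of_bound 1 (by simp)).trans (hw s)
    exact (this.const_mul_left (ket s t)).congr_left fun c => mul_comm _ _

end Controlled

lemma varOp_eq_of_ne {x : Var} (h : x ≠ .gam) (h' : x ≠ .gamInv) (c c' : ℝ) :
    varOp S c x = varOp S c' x := by
  cases x <;> first | rfl | contradiction

lemma Var.gamDeg_eq_zero {x : Var} (h : x ≠ .gam) (h' : x ≠ .gamInv) : x.gamDeg = 0 := by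
  cases x <;> first | rfl | contradiction

lemma controlled_varOp (x : Var) :
    Controlled (fun c => varOp S c.2 x) fun c => √c.2 ^ x.gamDeg := by
  by_cases h : x = .gam
  · subst h
    refine Controlled.diagOp fun s => IsBigO.of_bound 1 ?_
    filter_upwards [tendsto_heavy_snd.eventually_gt_atTop 0] with c hc
    have h0 : 0 < √c.2 := Real.sqrt_pos.mpr hc
    simp only [Var.gamDeg, zpow_neg, zpow_one, norm_inv, one_mul, Real.norm_eq_abs,
      abs_of_nonneg (Real.sqrt_nonneg _)]
    exact inv_anti₀ h0 (Real.sqrt_le_sqrt (by simp))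
  by_cases h' : x = .gamInv
  · subst h'
    refine Controlled.diagOp fun s => IsBigO.of_bound (√(levelL0 s.1 + 1)) ?_
    filter_upwards [tendsto_heavy_snd.eventually_ge_atTop 1] with c hc
    simp only [Var.gamDeg, zpow_one, Real.norm_eq_abs, abs_of_nonneg (Real.sqrt_nonneg _)]
    rw [← Real.sqrt_mul (by positivity)]
    refine Real.sqrt_le_sqrt ?_
    nlinarith [Nat.cast_nonneg (α := ℝ) (levelL0 s.1)]
  simp only [varOp_eq_of_ne h h' _ 0, Var.gamDeg_eq_zero h h', zpow_zero]
  exact Controlled.const _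

lemma controlled_monomialOp (l : List Var) (m : Var → ℕ) :
    Controlled (fun c => monomialOp l S c.2 m)
      fun c => √c.2 ^ (l.map fun x => (m x : ℤ) * x.gamDeg).sum := by
  induction l with
  | nil => simpa [monomialOp] using Controlled.const (1 : Op S)
  | cons x l ih =>
    refine ((((controlled_varOp x).pow (m x)).mul ih).congr ?_)
    filter_upwards [tendsto_sqrt_snd.eventually_gt_atTop 0] with c hc
    rw [List.map_cons, List.sum_cons, zpow_add₀ hc.ne', mul_comm (m x : ℤ), zpow_mul,
      zpow_natCast]

/-- Degrees in `γ⁻¹` are integers, so twice a degree being at most `2 * k + 1` already bounds it by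
`k`. -/
lemma isBigO_normalOrder {l : List Var} (hl : IsNormalOrder l) {p : ClassicalExpr} {a b k : ℤ}
    (hp : WeightBound a b p) (hk : b ≤ 2 * k + 1) (s t : State S) :
    (fun c : ℝ × ℝ => normalOrder l S c.2 p (ket s) t) =O[heavyVacuumLimit]
      fun c => √c.2 ^ k := by
  simp only [normalOrder_apply, LinearMap.sum_apply, Finsupp.finsetSum_apply,
    LinearMap.smul_apply, Finsupp.smul_apply]
  refine IsBigO.fun_sum fun m hm => IsBigO.const_smul_left ?_ _
  have h1 := (hp m hm).2
  rw [weight_eq_list_sum hl] at h1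
  obtain ⟨-, -, h⟩ := controlled_monomialOp l m s
  refine (h t).trans (IsBigO.of_bound 1 ?_)
  filter_upwards [tendsto_sqrt_snd.eventually_ge_atTop 1] with c hc
  rw [one_mul, Real.norm_of_nonneg (by positivity), Real.norm_of_nonneg (by positivity)]
  exact zpow_le_zpow_right₀ hc (by omega)

end Controlled

/-! ### The limit of the matrix of `α₂⁺`. -/

section Alpha

variable {l : List Var} {S : ℕ}

lemma alphaTerm_apply (l : List Var) (S : ℕ) (c₁ c₂ : ℝ) (n : ℕ) (s t : State S) :
    alphaTerm l S c₁ c₂ n (ket s) t =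
      (((occNum t.1 1 : ℝ) + c₁) ^ (-2 * (n : ℤ) + 1) : ℝ) *
        normalOrder l S c₂ (polyP n) (ket s) t := by
  rw [alphaTerm, Module.End.mul_apply, diagOp_apply]

lemma alphaTerm_apply_eq_zero (hl : IsNormalOrder l) {c₁ c₂ : ℝ} {n N : ℕ} (hn : 2 * N + 1 < n)
    {s t : State S} (hs : levelL0 s.1 ≤ N) (ht : levelL0 t.1 ≤ N) :
    alphaTerm l S c₁ c₂ n (ket s) t = 0 := by
  rw [alphaTerm_apply, polyP, normalOrder_apply_eq_zero hl
    (weightBound_expansionPair n (by omega)).1 (by omega), mul_zero]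

/-- Here `γ⁻¹` has power at most `(n + 3) / 2`, hence at most `n + 1` for every `n`, and `√c₂ ^ (n +
1) ≤ c₁ ^ (2n + 2)` against the prefactor `c₁ ^ (-(2n + 3))` leaves `1 / c₁`. -/
lemma tendsto_alphaTerm_zero (hl : IsNormalOrder l) (n : ℕ) (s t : State S) :
    Tendsto (fun c : ℝ × ℝ => alphaTerm l S c.1 c.2 (n + 2) (ket s) t) heavyVacuumLimit
      (𝓝 0) := by
  have hP := isBigO_normalOrder hl (k := (n + 1 : ℕ))
    (weightBound_expansionPair (n + 2) (by omega)).1 (by push_cast; linarith) s t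
  have hw : (fun c : ℝ × ℝ =>
      ((((occNum t.1 1 : ℝ) + c.1) ^ (-2 * ((n + 2 : ℕ) : ℤ) + 1) : ℝ) : ℂ)) =O[heavyVacuumLimit] fun c => (c.1 ^ (2 * n + 3))⁻¹ := by
    refine IsBigO.of_bound 1 ?_
    filter_upwards [eventually_fst_pos] with c hc
    have he : (-2 * ((n + 2 : ℕ) : ℤ) + 1) = -((2 * n + 3 : ℕ) : ℤ) := by push_cast; ring
    rw [he, zpow_neg, zpow_natCast, Complex.norm_real, Real.norm_of_nonneg (by positivity),
      Real.norm_of_nonneg (by positivity), one_mul]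
    gcongr
    simp
  have hinv : Tendsto (fun c : ℝ × ℝ => c.1⁻¹) heavyVacuumLimit (𝓝 0) :=
    tendsto_inv_atTop_zero.comp tendsto_heavy_fst
  refine ((hw.mul hP).congr_left fun c =>
    (alphaTerm_apply l S c.1 c.2 (n + 2) s t).symm).trans_tendsto (squeeze_zero' ?_ ?_ hinv)
  · filter_upwards [eventually_fst_pos] with c hc
    positivity
  · filter_upwards [eventually_fst_pos, tendsto_sqrt_snd_div_sq.eventually_le_const one_pos]
      with c hc hc'
    rw [div_le_one (by positivity)] at hc'
    rw [zpow_natCast, inv_mul_le_iff₀ (by positivity)]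
    calc √c.2 ^ (n + 1) ≤ (c.1 ^ 2) ^ (n + 1) := by gcongr
      _ = c.1 ^ (2 * n + 3) * c.1⁻¹ := by
        rw [← pow_mul, pow_succ c.1 (2 * n + 2), mul_assoc, mul_inv_cancel₀ hc.ne']
        ring

lemma tendsto_leading_coefficient (L k : ℕ) :
    Tendsto (fun c : ℝ × ℝ => ((k : ℝ) + c.1)⁻¹ * √(L + c.2) - √c.2 / c.1) heavyVacuumLimit
      (𝓝 0) := by
  have h1 : Tendsto (fun c : ℝ × ℝ => (L : ℝ) / √c.2 + k * (√c.2 / c.1 ^ 2)) heavyVacuumLimit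
      (𝓝 0) := by
    simpa using (tendsto_sqrt_snd.const_div_atTop (L : ℝ)).add
      (tendsto_sqrt_snd_div_sq.const_mul (k : ℝ))
  refine squeeze_zero_norm' ?_ h1
  filter_upwards [tendsto_heavy_fst.eventually_ge_atTop 1, tendsto_sqrt_snd.eventually_ge_atTop 1,
    tendsto_heavy_snd.eventually_ge_atTop 0] with c hc hr hc2
  have hk : (0 : ℝ) ≤ k := k.cast_nonneg
  have hL : (0 : ℝ) ≤ L := L.cast_nonneg
  set r := √c.2 with hr'
  set q := √(L + c.2) with hq
  have hqr : r ≤ q := Real.sqrt_le_sqrt (by linarith)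
  have hq2 : q ^ 2 = L + r ^ 2 := by rw [hq, hr', Real.sq_sqrt (by positivity), Real.sq_sqrt hc2]
  -- The first part is controlled by `(q - r) r ≤ q² - r² = L`, the second by `√c₂ ≪ c₁²`.
  have e : ((k : ℝ) + c.1)⁻¹ * q - r / c.1 =
      (q - r) / (k + c.1) - k * (r / (c.1 * (k + c.1))) := by
    field_simp
    ring
  have hkc : 1 ≤ k + c.1 := by linarith
  have b1 : (q - r) / (k + c.1) ≤ L / r := by
    refine (div_le_self (by linarith) hkc).trans ?_
    rw [le_div_iff₀ (by linarith)]
    nlinarith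
  have b1' : 0 ≤ (q - r) / (k + c.1) := div_nonneg (by linarith) (by linarith)
  have b2 : k * (r / (c.1 * (k + c.1))) ≤ k * (r / c.1 ^ 2) := by
    rw [sq]
    gcongr
    linarith
  have b2' : 0 ≤ k * (r / (c.1 * (k + c.1))) := by positivity
  rw [e, Real.norm_eq_abs, abs_le]
  constructor <;> linarith

lemma tendsto_alphaTerm_one (hl : IsNormalOrder l) (s t : State S) :
    Tendsto (fun c : ℝ × ℝ => alphaTerm l S c.1 c.2 1 (ket s) t -
      ((√c.2 / c.1 : ℝ) : ℂ) * spinPlus S (ket s) t) heavyVacuumLimit (𝓝 0) := by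
  have hs := isBigO_normalOrder hl (k := 0) (WeightBound.X .sigmaPlus)
    (by simp [Var.gamDeg]) s t
  simp only [zpow_zero] at hs
  have hw : Tendsto (fun c : ℝ × ℝ => ((((occNum t.1 1 : ℝ) + c.1)⁻¹ : ℝ) : ℂ)) heavyVacuumLimit
      (𝓝 0) := by
    have : Tendsto (fun c : ℝ × ℝ => ((occNum t.1 1 : ℝ) + c.1)⁻¹) heavyVacuumLimit (𝓝 0) :=
      tendsto_inv_atTop_zero.comp (tendsto_atTop_add_const_left _ _ tendsto_heavy_fst)
    exact_mod_cast (Complex.continuous_ofReal.tendsto 0).comp this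
  have hs' := hs.trans (isBigO_const_const (1 : ℝ) (one_ne_zero (α := ℂ)) heavyVacuumLimit)
  have h1 := ((isBigO_refl (fun c : ℝ × ℝ => ((((occNum t.1 1 : ℝ) + c.1)⁻¹ : ℝ) : ℂ))
    heavyVacuumLimit).mul hs').trans_tendsto (by simpa only [mul_one] using hw)
  have h2 := ((Complex.continuous_ofReal.tendsto 0).comp
    (tendsto_leading_coefficient (levelL0 s.1) (occNum t.1 1))).mul_const (spinPlus S (ket s) t)
  have h3 := h2.sub h1
  simp only [Complex.ofReal_zero, zero_mul, sub_zero] at h3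
  refine h3.congr fun c => ?_
  have hP : polyP 1 = symS - .X .sigmaPlus := by
    rw [polyP, expansionPair]
    ring
  rw [alphaTerm_apply, hP, map_sub, normalOrder_symS hl]
  simp only [LinearMap.sub_apply, Finsupp.sub_apply, Module.End.mul_apply, varOp, diagOp_ket,
    map_smul, Finsupp.smul_apply, Function.comp_apply, smul_eq_mul]
  norm_num
  ring

lemma alphaMatrix_apply (hl : IsNormalOrder l) (N : ℕ) (c₁ c₂ : ℝ) (i : CutState S N 0)
    (j : CutState S N 1) :
    alphaMatrix l S N c₁ c₂ i j =
      ∑ n ∈ Finset.range (2 * N + 1), alphaTerm l S c₁ c₂ (n + 1) (ket j.1) i.1 := by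
  rw [alphaMatrix, Matrix.of_apply]
  refine tsum_eq_sum fun n hn => ?_
  rw [Finset.mem_range] at hn
  exact alphaTerm_apply_eq_zero hl (by omega) j.2.1 i.2.1

lemma spinPlus_apply (s t : State S) : spinPlus S (ket s) t =
    if t.1 = s.1 ∧ t.2.1 = s.2.1 - 1 then
      ((√((S : ℝ) * (S + 1) - s.2.1 * (s.2.1 - 1)) : ℝ) : ℂ) else 0 := by
  classical
  rw [spinPlus, opOf_ket]
  by_cases h : t.1 = s.1 ∧ t.2.1 = s.2.1 - 1
  · have h' : |s.2.1 - 1| ≤ (S : ℤ) := h.2 ▸ t.2.2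
    have ht : t = (s.1, ⟨s.2.1 - 1, h'⟩) := Prod.ext h.1 (Subtype.ext h.2)
    rw [if_pos h, dif_pos h', ht]
    simp [ket]
  · rw [if_neg h]
    split_ifs
    · by_contra hne
      rw [(smul_ket_apply_ne_zero hne).2] at h
      simp at h
    · rfl

lemma spinMinus_apply (s t : State S) : spinMinus S (ket s) t =
    if t.1 = s.1 ∧ t.2.1 = s.2.1 + 1 then
      ((√((S : ℝ) * (S + 1) - s.2.1 * (s.2.1 + 1)) : ℝ) : ℂ) else 0 := by
  classical
  rw [spinMinus, opOf_ket]
  by_cases h : t.1 = s.1 ∧ t.2.1 = s.2.1 + 1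
  · have h' : |s.2.1 + 1| ≤ (S : ℤ) := h.2 ▸ t.2.2
    have ht : t = (s.1, ⟨s.2.1 + 1, h'⟩) := Prod.ext h.1 (Subtype.ext h.2)
    rw [if_pos h, dif_pos h', ht]
    simp [ket]
  · rw [if_neg h]
    split_ifs
    · by_contra hne
      rw [(smul_ket_apply_ne_zero hne).2] at h
      simp at h
    · rfl

lemma star_spinPlus_apply (s t : State S) :
    star (spinPlus S (ket s) t) = spinMinus S (ket t) s := by
  rw [spinPlus_apply, spinMinus_apply]
  by_cases h : t.1 = s.1 ∧ t.2.1 = s.2.1 - 1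
  · rw [if_pos h, if_pos ⟨h.1.symm, by omega⟩, RCLike.star_def, Complex.conj_ofReal, h.2]
    push_cast
    ring_nf
  · rw [if_neg h, if_neg fun h' => h ⟨h'.1.symm, by omega⟩, star_zero]

theorem tendsto_alphaMatrix (hl : IsNormalOrder l) (S N : ℕ) :
    Tendsto (fun c : ℝ × ℝ => (alphaMatrix l S N c.1 c.2).conjTranspose
      - ((√c.2 / c.1 : ℝ) : ℂ) • spinMinusMatrix S N) heavyVacuumLimit (𝓝 0) := by
  refine tendsto_pi_nhds.mpr fun j => tendsto_pi_nhds.mpr fun i => ?_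
  have h : Tendsto (fun c : ℝ × ℝ => (alphaTerm l S c.1 c.2 1 (ket j.1) i.1 -
      ((√c.2 / c.1 : ℝ) : ℂ) * spinPlus S (ket j.1) i.1) +
      ∑ n ∈ Finset.range (2 * N), alphaTerm l S c.1 c.2 (n + 2) (ket j.1) i.1)
      heavyVacuumLimit (𝓝 0) := by
    simpa using (tendsto_alphaTerm_one hl j.1 i.1).add
      (tendsto_finsetSum _ fun n _ => tendsto_alphaTerm_zero hl n j.1 i.1)
  have h' := (continuous_star.tendsto (0 : ℂ)).comp h
  rw [star_zero] at h'
  refine h'.congr fun c => ?_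
  rw [Matrix.sub_apply, Matrix.smul_apply, Matrix.conjTranspose_apply, alphaMatrix_apply hl,
    Finset.sum_range_succ', spinMinusMatrix, Matrix.of_apply, ← star_spinPlus_apply]
  simp only [Function.comp_apply, RCLike.star_def, map_add, map_sub, map_mul,
    Complex.conj_ofReal, smul_eq_mul, zero_add, add_assoc, one_add_one_eq_two]
  ring

end Alpha

/-! ### The kernel of `S₋` and the oscillator multiplicities. -/

section Mass

variable {S N : ℕ}

/-- The eigenvalues of `S₊ S₋`. -/
def spinGap (i : CutState S N 0) : ℝ := (S : ℝ) * (S + 1) - i.1.2.1 * (i.1.2.1 + 1)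

lemma spinGap_eq (i : CutState S N 0) :
    spinGap i = (((S - i.1.2.1) * (S + i.1.2.1 + 1) : ℤ) : ℝ) := by
  rw [spinGap]
  push_cast
  ring

lemma spinGap_eq_zero_iff (i : CutState S N 0) : spinGap i = 0 ↔ i.1.2.1 = S := by
  have h := abs_le.mp i.1.2.2
  rw [spinGap_eq, Int.cast_eq_zero, mul_eq_zero]
  omega

lemma spinGap_eq_zero_or_one_le (i : CutState S N 0) : spinGap i = 0 ∨ 1 ≤ spinGap i := by
  have h := abs_le.mp i.1.2.2
  rw [spinGap_eq_zero_iff]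
  by_cases hS : i.1.2.1 = S
  · exact Or.inl hS
  · right
    rw [spinGap_eq]
    have h1 : (1 : ℤ) ≤ S - i.1.2.1 := by omega
    have h2 : (1 : ℤ) ≤ S + i.1.2.1 + 1 := by omega
    exact_mod_cast one_le_mul_of_one_le_of_one_le h1 h2

lemma spinMinusMatrix_conjTranspose_mul_self (S N : ℕ) :
    (spinMinusMatrix S N).conjTranspose * spinMinusMatrix S N =
      Matrix.diagonal fun i => (spinGap i : ℂ) := by
  ext i j
  rw [Matrix.mul_apply]
  simp only [Matrix.conjTranspose_apply, spinMinusMatrix, Matrix.of_apply]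
  by_cases hij : i = j
  · subst hij
    rw [Matrix.diagonal_apply_eq]
    by_cases h0 : i.1.2.1 = S
    · rw [(spinGap_eq_zero_iff i).mpr h0, Complex.ofReal_zero]
      refine Finset.sum_eq_zero fun k _ => ?_
      have hk := abs_le.mp k.1.2.2
      rw [spinMinus_apply, if_neg (by omega), mul_zero]
    · have hi := abs_le.mp i.1.2.2
      have hiq := i.2
      -- `S₋` keeps the occupation numbers, so the only intermediate state stays below the cutoff
      -- and the truncated product is the full `S₊ S₋`.
      let k : CutState S N 1 := ⟨(i.1.1, ⟨i.1.2.1 + 1, abs_le.mpr (by omega)⟩), hiq.1, by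
        change i.1.2.1 + 1 - levelA3 i.1.1 = 1
        omega⟩
      rw [Finset.sum_eq_single k]
      · rw [spinMinus_apply, if_pos ⟨rfl, rfl⟩, RCLike.star_def, Complex.conj_ofReal,
          ← Complex.ofReal_mul]
        congr 1
        refine Real.mul_self_sqrt ?_
        rcases spinGap_eq_zero_or_one_le i with h | h <;> rw [spinGap] at h <;> linarith
      · intro k' _ hk'
        rw [spinMinus_apply, if_neg, mul_zero]
        exact fun h => hk' (Subtype.ext (Prod.ext h.1 (Subtype.ext h.2)))
      · simp
  · rw [Matrix.diagonal_apply_ne _ hij]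
    refine Finset.sum_eq_zero fun k _ => ?_
    rw [spinMinus_apply, spinMinus_apply]
    split_ifs with h1 h2
    · refine absurd (Subtype.ext (Prod.ext (h1.1.symm.trans h2.1) (Subtype.ext ?_))) hij
      have := h1.2.symm.trans h2.2
      omega
    all_goals simp

/-- For `χ₃ = 0` the condition `m = S` is `A₃⁽²⁾ = S`, so the occupation numbers determine the
state. -/
lemma card_eq_oscMultiplicity {k : ℕ} (hk : k ≤ N) :
    (Finset.univ.filter fun i : CutState S N 0 => spinGap i = 0 ∧ levelL0 i.1.1 = k).card =
      oscMultiplicity k S := by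
  rw [← Fintype.card_subtype, ← Nat.card_eq_fintype_card, oscMultiplicity]
  refine Nat.card_congr
    { toFun := fun i => ⟨i.1.1.1, i.2.2, ?_⟩
      invFun := fun n => ⟨⟨(n.1, ⟨S, by simp⟩), by simpa [n.2.1] using hk, by simp [n.2.2]⟩,
        (spinGap_eq_zero_iff _).mpr rfl, n.2.1⟩
      left_inv := fun i => ?_
      right_inv := fun n => rfl }
  · have h1 := (spinGap_eq_zero_iff _).mp i.2.1
    have h2 := i.1.2.2
    omega
  · have h1 := (spinGap_eq_zero_iff _).mp i.2.1
    exact Subtype.ext (Subtype.ext (Prod.ext rfl (Subtype.ext h1.symm)))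

end Mass

end LightConeString

open LightConeString
theorem lemma8 (l : List Var) (hl : IsNormalOrder l) (S N : ℕ) :
    Tendsto (fun c : ℝ × ℝ => (alphaMatrix l S N c.1 c.2).conjTranspose
        - ((Real.sqrt c.2 / c.1 : ℝ) : ℂ) • spinMinusMatrix S N) heavyVacuumLimit (𝓝 0) ∧
    ∀ (ε R : ℝ), 0 < ε → ε < 1 → ∀ᶠ c in heavyVacuumLimit,
      (∀ ℓ : ℕ, ℓ ≤ N →
        Nat.card {i : CutState S N 0 // |massEigenvalues l S N c.1 c.2 0 i - ℓ| < ε}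
          = oscMultiplicity ℓ S) ∧
      (∀ i : CutState S N 0, massEigenvalues l S N c.1 c.2 0 i ≤ R →
        ∃ ℓ : ℕ, ℓ ≤ N ∧ |massEigenvalues l S N c.1 c.2 0 i - ℓ| < ε) := by
  refine ⟨tendsto_alphaMatrix hl S N, fun ε R hε hε1 => ?_⟩
  have h := eigenvalues_cluster (D := fun i : CutState S N 0 => levelL0 i.1.1) (N := N)
    (fun i => i.2.1) (spinMinusMatrix_conjTranspose_mul_self S N) spinGap_eq_zero_or_one_le
    tendsto_sqrt_snd_div_fst (tendsto_alphaMatrix hl S N)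
    (fun c => massMatrix_isHermitian l S N c.1 c.2 0) (fun c => by simp [massMatrix]) hε hε1 R
  filter_upwards [h] with c hc
  exact ⟨fun k hk => (hc.1 k hk).trans (card_eq_oscMultiplicity hk), hc.2⟩
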